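/- Let $n\ge 2$ be an integer and let $\mathbb T^n=(\mathbb R/\mathbb Z)^n$, with Lebesgue measure $\mu$ (so $\mu(\mathbb T^n)=1$). For a prime $p$, an integer $m\ge 0$ and a polynomial system $G=(G_1,\dots,G_n)$ with $G_j\in\mathbb F_p[X_1,\dots,X_m]$, put, for $B\subset\mathbb T^n$, $$\mu_G(B)=\frac{1}{p^m}\,\#\Big\{x\in\mathbb F_p^m:\ \Big(\tfrac{G_1(x)}p,\dots,\tfrac{G_n(x)}p\Big)\in B\Big\},$$ and, for $v\in\mathbb Z^n$, let $S_G(v)=\sum_{x\in\mathbb F_p^m}e^{2\pi i(v_1G_1(x)+\dots+v_nG_n(x))/p}$. For $\eta\ge 0$ and $C>0$ we say that $G$ is of type $\eta$ with implied constant $C$ if, for all $v\in\mathbb Z^n$, $|S_G(v)|/p^m\le C$ when $v\in p\mathbb Z^n$ and $|S_G(v)|/p^m\le C\,p^{-\eta}$ otherwise. For $y\in\mathbb T^n$ and $R>0$ let $B_R(y)\subset\mathbb T^n$ be the closed Euclidean ball of radius $R$ about $y$, that is, the set of all $y+(u\bmod\mathbb Z^n)$ with $u\in\mathbb R^n$,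 $\|u\|_2\le R$. **Theorem 1.5.** For every $n\ge 2$ and $C>0$ there is a constant $K>0$, depending only on $n$ and $C$, such that for every $\eta\ge0$, every prime $p$, every $m\ge 0$, every polynomial system $G$ of $n$ polynomials in $m$ variables over $\mathbb F_p$ that is of type $\eta$ with implied constant $C$, every $y\in\mathbb T^n$ and every $0<R<1/2$, $$|\mu_G(B_R(y))-\mu(B_R(y))|\le\begin{cases}K\,R^{\frac{n(n-1)}{n+1}}\,p^{-\frac{2\min(\eta,n)}{n+1}} & \text{if } R>p^{-\min(\eta,n)/n},\\[2mm] K\,p^{-\min(\eta,n)} & \text{if } R\le p^{-\min(\eta,n)/n}.\end{cases}$$ -/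

import Mathlib

open MeasureTheory

/-- The point `(G₁(x)/p, …, Gₙ(x)/p)` of the torus `(ℝ/ℤ)ⁿ`. -/
noncomputable def torusPoint {p m n : ℕ} [Fact p.Prime]
    (G : Fin n → MvPolynomial (Fin m) (ZMod p)) (x : Fin m → ZMod p) : UnitAddTorus (Fin n) :=
  fun j => ZMod.toAddCircle (MvPolynomial.eval x (G j))

/-- The measure `μ_G(B)`: the number of points `G(x)/p`, `x ∈ 𝔽_pᵐ` (counted with multiplicity),
lying in `B`, divided by `p ^ m`. -/
noncomputable def systemMeasure {p m n : ℕ} [Fact p.Prime]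
    (G : Fin n → MvPolynomial (Fin m) (ZMod p)) (B : Set (UnitAddTorus (Fin n))) : ℝ :=
  ({x : Fin m → ZMod p | torusPoint G x ∈ B}.ncard : ℝ) / (p : ℝ) ^ m

/-- The Weyl sum `S_G(v) = ∑_{x ∈ 𝔽_pᵐ} e_p(v₁ G₁(x) + ⋯ + vₙ Gₙ(x))`, where
`e_p(r) = exp(2πir/p)` is the standard additive character of `ℤ/pℤ`. -/
noncomputable def weylSum {p m n : ℕ} [Fact p.Prime]
    (G : Fin n → MvPolynomial (Fin m) (ZMod p)) (v : Fin n → ℤ) : ℂ :=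
  ∑ x : Fin m → ZMod p, ZMod.stdAddChar (∑ j, (v j : ZMod p) * MvPolynomial.eval x (G j))

open Classical in
/-- `G` is of type `η` with implied constant `C`. -/
def IsOfType {p m n : ℕ} [Fact p.Prime]
    (G : Fin n → MvPolynomial (Fin m) (ZMod p)) (η C : ℝ) : Prop :=
  ∀ v : Fin n → ℤ, ‖weylSum G v‖ / (p : ℝ) ^ m ≤
    C * (if ∀ j, (p : ℤ) ∣ v j then 1 else (p : ℝ) ^ (-η))

/-- The (closed) Euclidean ball of radius `R` about `y` in `(ℝ/ℤ)ⁿ`: the translate by `y` of the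
image of the Euclidean ball of `ℝⁿ` under the projection `ℝⁿ → (ℝ/ℤ)ⁿ`. -/
def torusBall {n : ℕ} (y : UnitAddTorus (Fin n)) (R : ℝ) : Set (UnitAddTorus (Fin n)) :=
  {x | ∃ u : EuclideanSpace ℝ (Fin n), ‖u‖ ≤ R ∧ ∀ j, x j = y j + ((u j : ℝ) : UnitAddCircle)}

/-! The ball `B` of radius `R` is sandwiched between smooth functions: the balls of radii `R ± 2δ`,
pushed to the torus from `ℝⁿ` and convolved with the normalized autocorrelation of the indicator of
the ball of radius `δ` (`le_smoothedBall`, `smoothedBall_le`, `smoothedBall_eq_zero`).  The outer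
ball may overlap itself on the torus, which does no harm to a majorant.

The Fourier series of such a smoothed ball converges to it at every point (`hasSum_smoothedBall`):
the autocorrelation is an inner product in `L²`, expanded by Parseval's identity, and the series is
then integrated term by term.  Summing over the points of the system turns the nonzero frequencies
into Weyl sums.

The Fourier transform of a ball of radius `r` is `O(r^{(n-1)/2} |ξ|^{-(n+1)/2})`
(`exists_abs_integral_closedBall_cos_le`); slicing reduces this to the integrals
`∫₀¹ (1 - u²)^{(n-1)/2} cos(tu) du`, whose decay follows from a recursion raising the exponent by
one, started at the exponents `-1/2` and `0` (`exists_poisson_le`).  With a further factor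
`min(1, (δ|v|)^{-(n+1)/2})` from the smoothing, the coefficients sum over nonzero `v ∈ ℤⁿ` to
`O((r/δ)^{(n-1)/2})`, and over nonzero `v ∈ pℤⁿ` to `p^{-n}` times as much
(`sum_smoothWeight_le`, `sum_smoothWeight_le_of_dvd`).  Since `min(η, n)` is at most both `η` and
`n`, the two classes of frequencies together contribute `O(p^{-min(η,n)} (r/δ)^{(n-1)/2})`.

The change of volume between the radii `R` and `R ± 2δ` is `O(R^{n-1} δ)`, and the two errors
balance at `δ ≍ p^{-2 min(η,n)/(n+1)} R^{-(n-1)/(n+1)}` (`smoothing_scale`), which is below `R`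
exactly when `R > p^{-min(η,n)/n}`.  For smaller `R` the ball is enlarged to the radius
`p^{-min(η,n)/n}`, where the upper bound already has the claimed size. -/

/-! ### Decay of the Poisson integrals -/

/-- An oscillatory integral whose amplitude `g` is monotone, with at most a singularity
`(1 - u)^α` at `1`, decays like `t^{-(α+1)}`: the last piece `[1 - 1/t, 1]` is bounded trivially,
the rest by one integration by parts. -/
lemma abs_integral_mul_oscillating_le {α : ℝ} (hα : -1 < α) {g g' φ Φ : ℝ → ℝ}
    (hg : ∀ u ∈ Set.Ico (0 : ℝ) 1, HasDerivAt g (g' u) u)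
    (hg' : ContinuousOn g' (Set.Ico 0 1)) (hg'0 : ∀ u ∈ Set.Ico (0 : ℝ) 1, 0 ≤ g' u)
    (hgα : ∀ u ∈ Set.Ico (0 : ℝ) 1, g u ≤ (1 - u) ^ α) (hg0 : ∀ u ∈ Set.Ico (0 : ℝ) 1, 0 ≤ g u)
    (hgi : IntervalIntegrable g volume 0 1)
    (hΦ : ∀ x, HasDerivAt Φ (φ x) x) (hφc : Continuous φ) (hΦ1 : ∀ x, |Φ x| ≤ 1)
    (hφ1 : ∀ x, |φ x| ≤ 1) {t : ℝ} (ht : 1 ≤ t) :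
    |∫ u in (0 : ℝ)..1, g u * φ (t * u)| ≤ (2 + 1 / (α + 1)) * t ^ (-(α + 1)) := by
  have ht0 : 0 < t := by linarith
  set c : ℝ := 1 - 1 / t with hc
  have hc0 : 0 ≤ c := by
    have : 1 / t ≤ 1 := by rw [div_le_one ht0]; exact ht
    linarith
  have hc1 : c < 1 := by
    have : 0 < 1 / t := by positivity
    linarith
  have hΦc : Continuous Φ := continuous_iff_continuousAt.2 fun x => (hΦ x).continuousAt
  have hsub : Set.Icc 0 c ⊆ Set.Ico (0 : ℝ) 1 := fun u hu => ⟨hu.1, hu.2.trans_lt hc1⟩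
  have hfull : IntervalIntegrable (fun u => g u * φ (t * u)) volume 0 1 :=
    hgi.mul_continuousOn (by fun_prop)
  have hi1 : IntervalIntegrable (fun u => g u * φ (t * u)) volume 0 c :=
    hfull.mono_set (by
      rw [Set.uIcc_of_le hc0, Set.uIcc_of_le zero_le_one]
      exact Set.Icc_subset_Icc_right hc1.le)
  have hi2 : IntervalIntegrable (fun u => g u * φ (t * u)) volume c 1 :=
    hfull.mono_set (by
      rw [Set.uIcc_of_le hc1.le, Set.uIcc_of_le zero_le_one]
      exact Set.Icc_subset_Icc_left hc0)
  have hgpi : IntervalIntegrable g' volume 0 c :=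
    (hg'.mono (by rw [Set.uIcc_of_le hc0]; exact hsub)).intervalIntegrable
  have hFTC : ∫ u in (0 : ℝ)..c, g' u = g c - g 0 :=
    intervalIntegral.integral_eq_sub_of_hasDerivAt
      (fun u hu => hg u (hsub (by rwa [Set.uIcc_of_le hc0] at hu))) hgpi
  have hparts : ∫ u in (0 : ℝ)..c, g u * φ (t * u) =
      g c * (Φ (t * c) / t) - g 0 * (Φ (t * 0) / t) -
        ∫ u in (0 : ℝ)..c, g' u * (Φ (t * u) / t) := by
    refine intervalIntegral.integral_mul_deriv_eq_deriv_mul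
      (v := fun u => Φ (t * u) / t)
      (fun u hu => hg u (hsub (by rwa [Set.uIcc_of_le hc0] at hu))) (fun u _ => ?_) hgpi
      (Continuous.intervalIntegrable (by fun_prop) _ _)
    have h1 : HasDerivAt (fun u : ℝ => t * u) t u := by
      simpa using (hasDerivAt_id u).const_mul t
    have h2 := ((hΦ (t * u)).comp u h1).div_const t
    simpa [ht0.ne'] using h2
  have hΦt : ∀ x, |Φ x / t| ≤ 1 / t := fun x => by
    rw [abs_div, abs_of_pos ht0]
    exact div_le_div_of_nonneg_right (hΦ1 x) ht0.le
  have hgc := hg0 c ⟨hc0, hc1⟩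
  have hg00 := hg0 0 ⟨le_rfl, zero_lt_one⟩
  have hA : |∫ u in (0 : ℝ)..c, g u * φ (t * u)| ≤ 2 * g c * (1 / t) := by
    have h3 : |∫ u in (0 : ℝ)..c, g' u * (Φ (t * u) / t)| ≤ (g c - g 0) * (1 / t) := by
      rw [← hFTC, ← intervalIntegral.integral_mul_const, ← Real.norm_eq_abs]
      refine intervalIntegral.norm_integral_le_of_norm_le hc0 ?_ (hgpi.mul_const _)
      refine Filter.Eventually.of_forall fun u hu => ?_
      rw [Real.norm_eq_abs, abs_mul, abs_of_nonneg (hg'0 u ⟨hu.1.le, hu.2.trans_lt hc1⟩)]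
      exact mul_le_mul_of_nonneg_left (hΦt _) (hg'0 u ⟨hu.1.le, hu.2.trans_lt hc1⟩)
    have h1 : |g c * (Φ (t * c) / t)| ≤ g c * (1 / t) := by
      rw [abs_mul, abs_of_nonneg hgc]; exact mul_le_mul_of_nonneg_left (hΦt _) hgc
    have h2 : |g 0 * (Φ (t * 0) / t)| ≤ g 0 * (1 / t) := by
      rw [abs_mul, abs_of_nonneg hg00]; exact mul_le_mul_of_nonneg_left (hΦt _) hg00
    rw [hparts]
    calc _ ≤ |g c * (Φ (t * c) / t)| + |g 0 * (Φ (t * 0) / t)| +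
          |∫ u in (0 : ℝ)..c, g' u * (Φ (t * u) / t)| :=
          (abs_sub _ _).trans (by gcongr; exact abs_sub _ _)
      _ ≤ _ := by linarith
  have hB : |∫ u in c..1, g u * φ (t * u)| ≤ 1 / (α + 1) * t ^ (-(α + 1)) := by
    have hint : ∫ u in c..1, (1 - u) ^ α = 1 / (α + 1) * t ^ (-(α + 1)) := by
      rw [intervalIntegral.integral_comp_sub_left (fun x => x ^ α), integral_rpow (Or.inl hα)]
      have : (1 : ℝ) - c = t⁻¹ := by rw [hc]; simp
      rw [this, sub_self, Real.zero_rpow (by linarith), Real.inv_rpow ht0.le, Real.rpow_neg ht0.le]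
      ring
    rw [← hint, ← Real.norm_eq_abs]
    have hint' : IntervalIntegrable (fun u : ℝ => (1 - u) ^ α) volume c 1 := by
      have := (intervalIntegral.intervalIntegrable_rpow' hα (a := 1 - c) (b := 0)).comp_sub_left 1
      simpa using this
    refine intervalIntegral.norm_integral_le_of_norm_le hc1.le ?_ hint'
    have hne : ∀ᵐ u : ℝ, u ≠ 1 := by simp [ae_iff]
    filter_upwards [hne] with u hu1 hu
    have hu' : u ∈ Set.Ico (0 : ℝ) 1 := ⟨hc0.trans hu.1.le, lt_of_le_of_ne hu.2 hu1⟩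
    rw [Real.norm_eq_abs, abs_mul, abs_of_nonneg (hg0 u hu')]
    calc g u * |φ (t * u)| ≤ g u * 1 := mul_le_mul_of_nonneg_left (hφ1 _) (hg0 u hu')
      _ ≤ _ := by rw [mul_one]; exact hgα u hu'
  have hgct : g c * (1 / t) ≤ t ^ (-(α + 1)) := by
    have h1 : g c ≤ t⁻¹ ^ α := by
      have := hgα c ⟨hc0, hc1⟩
      rwa [show (1 : ℝ) - c = t⁻¹ by rw [hc]; simp] at this
    calc g c * (1 / t) ≤ t⁻¹ ^ α * (1 / t) := mul_le_mul_of_nonneg_right h1 (by positivity)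
      _ = t ^ (-(α + 1)) := by
        rw [Real.inv_rpow ht0.le, ← Real.rpow_neg ht0.le, neg_add, Real.rpow_add ht0,
          Real.rpow_neg_one, one_div]
  rw [← intervalIntegral.integral_add_adjacent_intervals hi1 hi2]
  calc _ ≤ _ := abs_add_le _ _
    _ ≤ 2 * g c * (1 / t) + 1 / (α + 1) * t ^ (-(α + 1)) := add_le_add hA hB
    _ ≤ _ := by nlinarith

/-- The Poisson integral `∫₀¹ (1 - u²)^α cos(tu) du`, a multiple of `t^{-α-1/2} J_{α+1/2}(t)`. -/
noncomputable def poissonCos (α t : ℝ) : ℝ :=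
  ∫ u in (0 : ℝ)..1, (1 - u ^ 2) ^ α * Real.cos (t * u)

/-- The companion `∫₀¹ u (1 - u²)^α sin(tu) du` of `poissonCos`, which makes integration by
parts close up into a recursion. -/
noncomputable def poissonSin (α t : ℝ) : ℝ :=
  ∫ u in (0 : ℝ)..1, u * (1 - u ^ 2) ^ α * Real.sin (t * u)

lemma one_sub_sq_rpow_le {α u : ℝ} (hα0 : α ≤ 0) (hu : u ∈ Set.Ico (0 : ℝ) 1) :
    (1 - u ^ 2) ^ α ≤ (1 - u) ^ α :=
  Real.rpow_le_rpow_of_nonpos (by linarith [hu.2]) (by nlinarith [hu.1, hu.2]) hα0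

lemma intervalIntegrable_one_sub_sq_rpow {α : ℝ} (hα : -1 < α) :
    IntervalIntegrable (fun u : ℝ => (1 - u ^ 2) ^ α) volume 0 1 := by
  rcases le_or_gt 0 α with h | h
  · refine Continuous.intervalIntegrable ?_ _ _
    exact (continuous_const.sub (continuous_pow 2)).rpow_const fun _ => Or.inr h
  · have h1 : IntervalIntegrable (fun u : ℝ => (1 - u) ^ α) volume 0 1 := by
      have := (intervalIntegral.intervalIntegrable_rpow' hα (a := 1) (b := 0)).comp_sub_left 1
      simpa using this
    refine h1.mono_fun
      (((measurable_id.pow_const 2).const_sub 1).pow_const α).aestronglyMeasurable ?_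
    have hne : ∀ᵐ u : ℝ, u ≠ 1 := by simp [ae_iff]
    rw [Filter.EventuallyLE, ae_restrict_iff' measurableSet_uIoc]
    filter_upwards [hne] with u hu1 hu
    rw [Set.uIoc_of_le zero_le_one] at hu
    have hu' : u ∈ Set.Ico (0 : ℝ) 1 := ⟨hu.1.le, lt_of_le_of_ne hu.2 hu1⟩
    rw [Real.norm_of_nonneg (Real.rpow_nonneg (by nlinarith [hu'.1, hu'.2]) _),
      Real.norm_of_nonneg (Real.rpow_nonneg (by linarith [hu'.2]) _)]
    exact one_sub_sq_rpow_le h.le hu'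

lemma hasDerivAt_one_sub_sq_rpow {α u : ℝ} (hu : u ^ 2 < 1) :
    HasDerivAt (fun u : ℝ => (1 - u ^ 2) ^ α) (-(2 * α * (u * (1 - u ^ 2) ^ (α - 1)))) u := by
  have h1 : HasDerivAt (fun u : ℝ => 1 - u ^ 2) (-(2 * u)) u := by
    simpa using (hasDerivAt_pow 2 u).const_sub 1
  convert! h1.rpow_const (p := α) (Or.inl (by linarith)) using 1
  ring

lemma hasDerivAt_mul_one_sub_sq_rpow {α u : ℝ} (hu : u ^ 2 < 1) :
    HasDerivAt (fun u : ℝ => u * (1 - u ^ 2) ^ α)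
      ((1 + 2 * α) * (1 - u ^ 2) ^ α - 2 * α * (1 - u ^ 2) ^ (α - 1)) u := by
  convert! (hasDerivAt_id u).mul (hasDerivAt_one_sub_sq_rpow (α := α) hu) using 1
  have : (1 - u ^ 2) ^ α = (1 - u ^ 2) ^ (α - 1) * (1 - u ^ 2) := by
    rw [← Real.rpow_add_one (by linarith)]; ring_nf
  rw [this, id]
  ring

/-- The start of the recursion: for `-1 < α ≤ 0` both amplitudes are monotone on `[0, 1)`. -/
lemma exists_poisson_le_of_nonpos {α : ℝ} (hα : -1 < α) (hα0 : α ≤ 0) :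
    ∃ K : ℝ, ∀ t : ℝ, 1 ≤ t → |poissonCos α t| ≤ K * t ^ (-(α + 1)) ∧
      |poissonSin α t| ≤ K * t ^ (-(α + 1)) := by
  have hsq : ∀ u ∈ Set.Ico (0 : ℝ) 1, u ^ 2 < 1 := fun u hu => by nlinarith [hu.1, hu.2]
  have hpos : ∀ (β : ℝ), ∀ u ∈ Set.Ico (0 : ℝ) 1, 0 ≤ (1 - u ^ 2) ^ β := fun β u hu =>
    Real.rpow_nonneg (by linarith [hsq u hu]) _
  have hcont : ∀ β : ℝ, ContinuousOn (fun u : ℝ => (1 - u ^ 2) ^ β) (Set.Ico 0 1) := fun β =>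
    ContinuousOn.rpow_const (by fun_prop) fun u hu => Or.inl (by linarith [hsq u hu])
  have hii := intervalIntegrable_one_sub_sq_rpow hα
  refine ⟨2 + 1 / (α + 1), fun t ht => ⟨?_, ?_⟩⟩
  · refine abs_integral_mul_oscillating_le hα
      (fun u hu => hasDerivAt_one_sub_sq_rpow (hsq u hu)) ?_ ?_
      (fun u hu => one_sub_sq_rpow_le hα0 hu) (hpos α) hii
      Real.hasDerivAt_sin Real.continuous_cos Real.abs_sin_le_one Real.abs_cos_le_one ht
    · have := hcont (α - 1); fun_prop
    · intro u hu
      have := mul_nonneg hu.1 (hpos (α - 1) u hu)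
      nlinarith
  · refine abs_integral_mul_oscillating_le hα
      (fun u hu => hasDerivAt_mul_one_sub_sq_rpow (hsq u hu)) ?_ ?_ ?_ ?_ ?_
      (Φ := fun x => - Real.cos x) (fun x => by simpa using! (Real.hasDerivAt_cos x).neg)
      Real.continuous_sin (fun x => by simpa using Real.abs_cos_le_one x) Real.abs_sin_le_one ht
    · have := hcont (α - 1); have := hcont α; fun_prop
    · intro u hu
      have h1 := hpos (α - 1) u hu
      have : (1 - u ^ 2) ^ α = (1 - u ^ 2) ^ (α - 1) * (1 - u ^ 2) := by
        rw [← Real.rpow_add_one (by linarith [hsq u hu])]; ring_nf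
      have h2 := hpos α u hu
      have h3 : (1 - u ^ 2) ^ α ≤ (1 - u ^ 2) ^ (α - 1) := by
        rw [this]; nlinarith [sq_nonneg u]
      nlinarith
    · intro u hu
      have := one_sub_sq_rpow_le hα0 hu
      have h2 := hpos α u hu
      nlinarith [hu.1, hu.2]
    · exact fun u hu => mul_nonneg hu.1 (hpos α u hu)
    · exact hii.continuousOn_mul (by fun_prop)

lemma hasDerivAt_sin_mul_div {t : ℝ} (ht : 0 < t) (u : ℝ) :
    HasDerivAt (fun u => Real.sin (t * u) / t) (Real.cos (t * u)) u := by
  have h1 : HasDerivAt (fun u : ℝ => t * u) t u := by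
    simpa using (hasDerivAt_id u).const_mul t
  simpa [ht.ne'] using ((Real.hasDerivAt_sin (t * u)).comp u h1).div_const t

lemma hasDerivAt_neg_cos_mul_div {t : ℝ} (ht : 0 < t) (u : ℝ) :
    HasDerivAt (fun u => -Real.cos (t * u) / t) (Real.sin (t * u)) u := by
  have h1 : HasDerivAt (fun u : ℝ => t * u) t u := by
    simpa using (hasDerivAt_id u).const_mul t
  simpa [ht.ne'] using ((Real.hasDerivAt_cos (t * u)).comp u h1).neg.div_const t

lemma mul_poissonCos {α t : ℝ} (hα : 0 < α) (ht : 0 < t) :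
    t * poissonCos α t = 2 * α * poissonSin (α - 1) t := by
  have hcont : Continuous (fun u : ℝ => (1 - u ^ 2) ^ α) :=
    (continuous_const.sub (continuous_pow 2)).rpow_const fun _ => Or.inr hα.le
  have hii := (intervalIntegrable_one_sub_sq_rpow (α := α - 1) (by linarith)).continuousOn_mul
    (g := fun u : ℝ => u) (by fun_prop)
  have h := intervalIntegral.integral_mul_deriv_eq_deriv_mul_of_hasDerivAt (a := 0) (b := 1)
    (u := fun u : ℝ => (1 - u ^ 2) ^ α) (v := fun u => Real.sin (t * u) / t)
    (u' := fun u => -(2 * α * (u * (1 - u ^ 2) ^ (α - 1)))) (v' := fun u => Real.cos (t * u))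
    hcont.continuousOn (by fun_prop)
    (fun x hx => hasDerivAt_one_sub_sq_rpow (by
      simp only [min_eq_left zero_le_one, max_eq_right zero_le_one (α := ℝ)] at hx
      nlinarith [hx.1, hx.2]))
    (fun x _ => hasDerivAt_sin_mul_div ht x) (hii.const_mul (2 * α)).neg
    (Continuous.intervalIntegrable (by fun_prop) _ _)
  rw [poissonCos, h, poissonSin]
  have h2 : ∀ u : ℝ, -(2 * α * (u * (1 - u ^ 2) ^ (α - 1))) * (Real.sin (t * u) / t) =
      (-(2 * α) / t) * (u * (1 - u ^ 2) ^ (α - 1) * Real.sin (t * u)) := fun u => by ring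
  simp only [h2, intervalIntegral.integral_const_mul]
  simp [Real.zero_rpow hα.ne']
  field_simp

lemma mul_poissonSin {α t : ℝ} (hα : 0 < α) (ht : 0 < t) :
    t * poissonSin α t = (1 + 2 * α) * poissonCos α t - 2 * α * poissonCos (α - 1) t := by
  have hcont : Continuous (fun u : ℝ => (1 - u ^ 2) ^ α) :=
    (continuous_const.sub (continuous_pow 2)).rpow_const fun _ => Or.inr hα.le
  have hii := intervalIntegrable_one_sub_sq_rpow (α := α - 1) (by linarith)
  have hii' := intervalIntegrable_one_sub_sq_rpow (α := α) (by linarith)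
  have h := intervalIntegral.integral_mul_deriv_eq_deriv_mul_of_hasDerivAt (a := 0) (b := 1)
    (u := fun u : ℝ => u * (1 - u ^ 2) ^ α) (v := fun u => -Real.cos (t * u) / t)
    (u' := fun u => (1 + 2 * α) * (1 - u ^ 2) ^ α - 2 * α * (1 - u ^ 2) ^ (α - 1))
    (v' := fun u => Real.sin (t * u))
    (by fun_prop) (by fun_prop)
    (fun x hx => hasDerivAt_mul_one_sub_sq_rpow (by
      simp only [min_eq_left zero_le_one, max_eq_right zero_le_one (α := ℝ)] at hx
      nlinarith [hx.1, hx.2]))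
    (fun x _ => hasDerivAt_neg_cos_mul_div ht x)
    ((hii'.const_mul (1 + 2 * α)).sub (hii.const_mul (2 * α)))
    (Continuous.intervalIntegrable (by fun_prop) _ _)
  rw [poissonSin, h, poissonCos, poissonCos]
  have h2 : ∀ u : ℝ, ((1 + 2 * α) * (1 - u ^ 2) ^ α - 2 * α * (1 - u ^ 2) ^ (α - 1)) *
      (-Real.cos (t * u) / t) = (-(1 + 2 * α) / t) * ((1 - u ^ 2) ^ α * Real.cos (t * u)) -
      (-(2 * α) / t) * ((1 - u ^ 2) ^ (α - 1) * Real.cos (t * u)) := fun u => by ring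
  simp only [h2]
  rw [intervalIntegral.integral_sub
    ((hii'.mul_continuousOn (by fun_prop)).const_mul _)
    ((hii.mul_continuousOn (by fun_prop)).const_mul _),
    intervalIntegral.integral_const_mul, intervalIntegral.integral_const_mul]
  simp [Real.zero_rpow hα.ne']
  field_simp
  ring

/-- Decay of the Poisson integrals: `O(t^{-(α+1)})`, obtained from `-1 < α ≤ 0` by the
recursions `mul_poissonCos` and `mul_poissonSin`, which raise `α` by one. -/
lemma exists_poisson_le {α : ℝ} (hα : -1 < α) (hα0 : α ≤ 0) (k : ℕ) :
    ∃ K : ℝ, ∀ t : ℝ, 1 ≤ t → |poissonCos (α + k) t| ≤ K * t ^ (-(α + k + 1)) ∧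
      |poissonSin (α + k) t| ≤ K * t ^ (-(α + k + 1)) := by
  induction k with
  | zero => simpa using exists_poisson_le_of_nonpos hα hα0
  | succ k ih =>
    obtain ⟨K, hK⟩ := ih
    have hβ0 : 0 < α + k + 1 := by
      have : (0 : ℝ) ≤ k := k.cast_nonneg
      linarith
    set β := α + k + 1 with hβ
    have hK0 : 0 ≤ K := by simpa using (abs_nonneg _).trans (hK 1 le_rfl).1
    refine ⟨(1 + 2 * β) * (2 * β * K) + 2 * β * K, fun t ht => ?_⟩
    have ht0 : 0 < t := by linarith
    obtain ⟨h1, h2⟩ := hK t ht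
    have e1 : α + ((k + 1 : ℕ) : ℝ) = β := by push_cast; ring
    have e2 : α + k = β - 1 := by rw [hβ]; ring
    rw [e2] at h1 h2
    rw [e1]
    have hpow : t ^ (-(β + 1)) = t ^ (-β) * t⁻¹ := by
      rw [neg_add, Real.rpow_add ht0, Real.rpow_neg_one]
    have hp0 : 0 < t ^ (-β) := Real.rpow_pos_of_pos ht0 _
    have hp0' : 0 < t ^ (-(β + 1)) := Real.rpow_pos_of_pos ht0 _
    have hmono : t ^ (-(β + 1)) ≤ t ^ (-β) :=
      Real.rpow_le_rpow_of_exponent_le ht (by linarith)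
    have hc : |poissonCos β t| ≤ 2 * β * K * t ^ (-(β + 1)) := by
      have := mul_poissonCos hβ0 ht0
      have h3 : poissonCos β t = 2 * β * poissonSin (β - 1) t * t⁻¹ := by
        rw [← this]; field_simp
      rw [h3, abs_mul, abs_mul, abs_of_pos (by positivity : 0 < 2 * β),
        abs_of_pos (inv_pos.2 ht0), hpow]
      calc _ ≤ 2 * β * (K * t ^ (-β)) * t⁻¹ := by gcongr
        _ = _ := by ring
    refine ⟨hc.trans ?_, ?_⟩
    · gcongr
      have : 0 ≤ β * K := by positivity
      nlinarith
    · have h3 : poissonSin β t =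
          ((1 + 2 * β) * poissonCos β t - 2 * β * poissonCos (β - 1) t) * t⁻¹ := by
        rw [← mul_poissonSin hβ0 ht0]; field_simp
      rw [h3, abs_mul, abs_of_pos (inv_pos.2 ht0), hpow]
      calc _ ≤ (|(1 + 2 * β) * poissonCos β t| + |2 * β * poissonCos (β - 1) t|) * t⁻¹ := by
            gcongr; exact abs_sub _ _
        _ ≤ ((1 + 2 * β) * (2 * β * K * t ^ (-β)) + 2 * β * (K * t ^ (-β))) * t⁻¹ := by
            rw [abs_mul, abs_mul, abs_of_pos (by positivity : 0 < 2 * β),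
              abs_of_pos (by positivity : 0 < 1 + 2 * β)]
            gcongr
            exact hc.trans (by gcongr)
        _ = _ := by ring

/-- The decay of `∫₀¹ (1 - u²)^{k/2} cos(tu) du` for all `t > 0`. -/
lemma exists_poissonCos_half_le (k : ℕ) :
    ∃ K : ℝ, 0 < K ∧ ∀ t : ℝ, 0 < t →
      |poissonCos ((k : ℝ) / 2) t| ≤ K * t ^ (-((k : ℝ) / 2 + 1)) := by
  have key : ∃ K : ℝ, ∀ t : ℝ, 1 ≤ t →
      |poissonCos ((k : ℝ) / 2) t| ≤ K * t ^ (-((k : ℝ) / 2 + 1)) := by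
    rcases Nat.even_or_odd' k with ⟨j, rfl | rfl⟩
    · obtain ⟨K, hK⟩ := exists_poisson_le (α := 0) (by norm_num) le_rfl j
      refine ⟨K, fun t ht => ?_⟩
      have := (hK t ht).1
      simpa using this
    -- For odd `k` the recursion starts at `-1/2`, so it takes one step more than `k / 2`.
    · obtain ⟨K, hK⟩ := exists_poisson_le (α := -1 / 2) (by norm_num) (by norm_num) (j + 1)
      refine ⟨K, fun t ht => ?_⟩
      have := (hK t ht).1
      have e : (-1 / 2 : ℝ) + ((j + 1 : ℕ) : ℝ) = ((2 * j + 1 : ℕ) : ℝ) / 2 := by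
        push_cast; ring
      rwa [e] at this
  obtain ⟨K, hK⟩ := key
  refine ⟨max K 1, by positivity, fun t ht => ?_⟩
  rcases le_total 1 t with h | h
  · exact (hK t h).trans (by gcongr; exact le_max_left _ _)
  · have h1 : |poissonCos ((k : ℝ) / 2) t| ≤ 1 := by
      have : ‖∫ u in (0 : ℝ)..1, (1 - u ^ 2) ^ ((k : ℝ) / 2) * Real.cos (t * u)‖ ≤ 1 * |1 - 0| := by
        refine intervalIntegral.norm_integral_le_of_norm_le_const fun u hu => ?_
        rw [Set.uIoc_of_le zero_le_one] at hu
        have hu2 : 0 ≤ 1 - u ^ 2 := by nlinarith [hu.1, hu.2]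
        rw [norm_mul, Real.norm_of_nonneg (Real.rpow_nonneg hu2 _)]
        refine mul_le_one₀ (Real.rpow_le_one hu2 (by nlinarith [sq_nonneg u]) (by positivity))
          (norm_nonneg _) (Real.abs_cos_le_one _)
      simpa [poissonCos] using this
    have h2 : 1 ≤ t ^ (-((k : ℝ) / 2 + 1)) :=
      Real.one_le_rpow_of_pos_of_le_one_of_nonpos ht h (by
        have : (0 : ℝ) ≤ k := k.cast_nonneg
        linarith)
    calc _ ≤ 1 := h1
      _ ≤ max K 1 * t ^ (-((k : ℝ) / 2 + 1)) := one_le_mul_of_one_le_of_one_le (le_max_right _ _) h2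

/-! ### The Fourier transform of a Euclidean ball -/

/-- The isomorphism `ℝ × ℝᴺ → ℝᴺ⁺¹` prepending a coordinate. -/
noncomputable def euclideanCons (N : ℕ) :
    ℝ × EuclideanSpace ℝ (Fin N) ≃ᵐ EuclideanSpace ℝ (Fin (N + 1)) :=
  ((MeasurableEquiv.refl ℝ).prodCongr (MeasurableEquiv.toLp 2 (Fin N → ℝ)).symm).trans
    ((MeasurableEquiv.piFinSuccAbove (fun _ : Fin (N + 1) => ℝ) 0).symm.trans
      (MeasurableEquiv.toLp 2 (Fin (N + 1) → ℝ)))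

lemma euclideanCons_zero (N : ℕ) (x : ℝ × EuclideanSpace ℝ (Fin N)) :
    euclideanCons N x 0 = x.1 := by
  simp [euclideanCons, MeasurableEquiv.piFinSuccAbove]
  rfl

lemma euclideanCons_succ (N : ℕ) (x : ℝ × EuclideanSpace ℝ (Fin N)) (i : Fin N) :
    euclideanCons N x i.succ = x.2 i := by
  simp [euclideanCons, MeasurableEquiv.piFinSuccAbove]
  rfl

lemma measurePreserving_euclideanCons (N : ℕ) : MeasurePreserving (euclideanCons N) := by
  have h1 : MeasurePreserving ((MeasurableEquiv.refl ℝ).prodCongr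
      (MeasurableEquiv.toLp 2 (Fin N → ℝ)).symm) :=
    (MeasurePreserving.id (volume : Measure ℝ)).prod (PiLp.volume_preserving_ofLp (Fin N))
  exact (PiLp.volume_preserving_toLp (Fin (N + 1))).comp
    ((volume_preserving_piFinSuccAbove (fun _ : Fin (N + 1) => ℝ) 0).symm.comp h1)

lemma norm_sq_euclideanCons (N : ℕ) (x : ℝ × EuclideanSpace ℝ (Fin N)) :
    ‖euclideanCons N x‖ ^ 2 = x.1 ^ 2 + ‖x.2‖ ^ 2 := by
  rw [EuclideanSpace.real_norm_sq_eq, EuclideanSpace.real_norm_sq_eq, Fin.sum_univ_succ,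
    euclideanCons_zero]
  simp only [euclideanCons_succ]

lemma volume_real_norm_sq_le (N : ℕ) {a : ℝ} (ha : 0 ≤ a) :
    volume.real {w : EuclideanSpace ℝ (Fin N) | ‖w‖ ^ 2 ≤ a} =
      a ^ ((N : ℝ) / 2) * volume.real (Metric.ball (0 : EuclideanSpace ℝ (Fin N)) 1) := by
  have hset : {w : EuclideanSpace ℝ (Fin N) | ‖w‖ ^ 2 ≤ a} =
      Metric.closedBall (0 : EuclideanSpace ℝ (Fin N)) (√a) := by
    ext w
    rw [Set.mem_ofPred_eq, mem_closedBall_zero_iff, Real.le_sqrt (norm_nonneg _) ha]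
  rw [hset, Measure.addHaar_real_closedBall _ _ (Real.sqrt_nonneg _), finrank_euclideanSpace_fin,
    Real.sqrt_eq_rpow, ← Real.rpow_natCast, ← Real.rpow_mul ha]
  congr 2
  ring

/-- Slicing the unit ball orthogonally to the frequency: its Fourier transform is a multiple of a
Poisson integral. -/
lemma integral_closedBall_cos_coord (N : ℕ) (t : ℝ) :
    ∫ u in Metric.closedBall (0 : EuclideanSpace ℝ (Fin (N + 1))) 1, Real.cos (t * u 0) =
      2 * volume.real (Metric.ball (0 : EuclideanSpace ℝ (Fin N)) 1) *
        poissonCos ((N : ℝ) / 2) t := by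
  set S : Set (ℝ × EuclideanSpace ℝ (Fin N)) := {x | x.1 ^ 2 + ‖x.2‖ ^ 2 ≤ 1} with hS
  set κ := volume.real (Metric.ball (0 : EuclideanSpace ℝ (Fin N)) 1) with hκ
  have hmp := measurePreserving_euclideanCons N
  have hpre : euclideanCons N ⁻¹' Metric.closedBall 0 1 = S := by
    ext x
    rw [Set.mem_preimage, mem_closedBall_zero_iff, hS, Set.mem_ofPred_eq, ← norm_sq_euclideanCons,
      sq_le_one_iff₀ (norm_nonneg _)]
  have hSm : MeasurableSet S := by
    rw [← hpre]; exact (euclideanCons N).measurable measurableSet_closedBall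
  have hSfin : volume S ≠ ⊤ := by
    rw [← hpre, hmp.measure_preimage_equiv]
    exact measure_closedBall_lt_top.ne
  have hint : Integrable (S.indicator fun x => Real.cos (t * x.1))
      ((volume : Measure ℝ).prod (volume : Measure (EuclideanSpace ℝ (Fin N)))) := by
    refine (integrable_indicator_iff hSm).2 ?_
    refine Measure.integrableOn_of_bounded (M := 1) hSfin ?_ ?_
    · exact Continuous.aestronglyMeasurable (by fun_prop)
    · exact Filter.Eventually.of_forall fun x => Real.abs_cos_le_one _
  rw [← hmp.setIntegral_preimage_emb (euclideanCons N).measurableEmbedding, hpre,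
    ← integral_indicator hSm]
  simp only [euclideanCons_zero]
  rw [Measure.volume_eq_prod, integral_prod _ hint]
  have hslice : ∀ s : ℝ, ∫ w, S.indicator (fun x => Real.cos (t * x.1)) (s, w) =
      (Set.Icc (-1) 1).indicator
        (fun s => κ * ((1 - s ^ 2) ^ ((N : ℝ) / 2) * Real.cos (t * s))) s := by
    intro s
    have e1 : ∀ w, S.indicator (fun x => Real.cos (t * x.1)) (s, w) =
        {w : EuclideanSpace ℝ (Fin N) | ‖w‖ ^ 2 ≤ 1 - s ^ 2}.indicator
          (fun _ => Real.cos (t * s)) w := fun w => by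
      simp only [Set.indicator, hS, Set.mem_ofPred_eq, le_sub_iff_add_le, add_comm]
    have hm : MeasurableSet {w : EuclideanSpace ℝ (Fin N) | ‖w‖ ^ 2 ≤ 1 - s ^ 2} :=
      measurableSet_le (by fun_prop) (by fun_prop)
    simp only [e1]
    rw [integral_indicator_const _ hm]
    by_cases hs : s ∈ Set.Icc (-1 : ℝ) 1
    · rw [Set.indicator_of_mem hs, volume_real_norm_sq_le N (by nlinarith [hs.1, hs.2]),
        smul_eq_mul]
      ring
    · rw [Set.indicator_of_notMem hs]
      have hs1 : 1 < s ^ 2 := by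
        rw [one_lt_sq_iff_one_lt_abs]
        by_contra h
        exact hs (abs_le.1 (not_lt.1 h))
      have : {w : EuclideanSpace ℝ (Fin N) | ‖w‖ ^ 2 ≤ 1 - s ^ 2} = ∅ := by
        ext w
        simp only [Set.mem_ofPred_eq, Set.mem_empty_iff_false, iff_false, not_le]
        nlinarith [sq_nonneg ‖w‖]
      simp [this]
  simp only [hslice]
  rw [integral_indicator measurableSet_Icc, integral_Icc_eq_integral_Ioc,
    ← intervalIntegral.integral_of_le (by norm_num), intervalIntegral.integral_const_mul]
  have hc : Continuous fun s : ℝ => (1 - s ^ 2) ^ ((N : ℝ) / 2) * Real.cos (t * s) :=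
    ((continuous_const.sub (continuous_pow 2)).rpow_const fun _ => Or.inr (by positivity)).mul
      (by fun_prop)
  rw [← intervalIntegral.integral_add_adjacent_intervals (hc.intervalIntegrable (-1) 0)
    (hc.intervalIntegrable 0 1)]
  have hneg : ∫ s in (-1 : ℝ)..0, (1 - s ^ 2) ^ ((N : ℝ) / 2) * Real.cos (t * s) =
      poissonCos ((N : ℝ) / 2) t := by
    have := intervalIntegral.integral_comp_neg (a := -1) (b := 0)
      (fun s : ℝ => (1 - s ^ 2) ^ ((N : ℝ) / 2) * Real.cos (t * s))
    simpa [poissonCos] using this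
  rw [hneg, poissonCos]
  ring

/-- Coordinates in which `ξ` points along the first axis. -/
lemma exists_orthonormalBasis_repr_eq (N : ℕ) (ξ : EuclideanSpace ℝ (Fin (N + 1))) (hξ : ξ ≠ 0) :
    ∃ b : OrthonormalBasis (Fin (N + 1)) ℝ (EuclideanSpace ℝ (Fin (N + 1))),
      ∀ u, inner ℝ ξ u = ‖ξ‖ * b.repr u 0 := by
  have hn : ‖ξ‖ ≠ 0 := norm_ne_zero_iff.2 hξ
  obtain ⟨b, hb⟩ := Orthonormal.exists_orthonormalBasis_extension_of_card_eq (𝕜 := ℝ)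
    (E := EuclideanSpace ℝ (Fin (N + 1))) (ι := Fin (N + 1)) (by simp)
    (v := fun _ => (‖ξ‖⁻¹ : ℝ) • ξ) (s := {0}) (by
      refine ⟨fun i => ?_, fun i j hij => (hij (Subsingleton.elim _ _)).elim⟩
      simp [norm_smul, hn])
  refine ⟨b, fun u => ?_⟩
  rw [b.repr_apply_apply, hb 0 rfl, inner_smul_left]
  simp [hn]

/-- Rotation invariance and scaling reduce every frequency and radius to
`integral_closedBall_cos_coord`. -/
lemma integral_closedBall_cos_inner (N : ℕ) {r : ℝ} (hr : 0 < r)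
    (ξ : EuclideanSpace ℝ (Fin (N + 1))) (hξ : ξ ≠ 0) :
    ∫ u in Metric.closedBall (0 : EuclideanSpace ℝ (Fin (N + 1))) r, Real.cos (inner ℝ ξ u) =
      r ^ (N + 1) * (2 * volume.real (Metric.ball (0 : EuclideanSpace ℝ (Fin N)) 1) *
        poissonCos ((N : ℝ) / 2) (r * ‖ξ‖)) := by
  obtain ⟨b, hb⟩ := exists_orthonormalBasis_repr_eq N ξ hξ
  have h1 := Measure.setIntegral_comp_smul (volume : Measure (EuclideanSpace ℝ (Fin (N + 1))))
    (fun u => Real.cos (inner ℝ ξ u)) (Metric.closedBall 0 1) hr.ne'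
  rw [smul_unitClosedBall, Real.norm_of_nonneg hr.le, finrank_euclideanSpace_fin,
    abs_of_pos (by positivity), smul_eq_mul] at h1
  have h2 := b.measurePreserving_repr.setIntegral_preimage_emb
    (b.repr.toHomeomorph.measurableEmbedding)
    (fun u => Real.cos (r * ‖ξ‖ * u 0)) (Metric.closedBall 0 1)
  have hpre : b.repr ⁻¹' Metric.closedBall 0 1 = Metric.closedBall 0 1 := by
    ext u; simp
  rw [hpre, integral_closedBall_cos_coord] at h2
  rw [← h2]
  have h3 : ∀ u, Real.cos (inner ℝ ξ (r • u)) = Real.cos (r * ‖ξ‖ * b.repr u 0) := fun u => by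
    rw [inner_smul_right, hb u, mul_assoc]
  simp only [h3] at h1
  rw [h1]
  field_simp

/-- Decay of the Fourier transform of a Euclidean ball of radius `r` in dimension `n = N + 1`:
`O(r^{(n-1)/2} |ξ|^{-(n+1)/2})`. -/
lemma exists_abs_integral_closedBall_cos_le (N : ℕ) :
    ∃ K : ℝ, 0 < K ∧ ∀ r : ℝ, 0 < r → ∀ ξ : EuclideanSpace ℝ (Fin (N + 1)), ξ ≠ 0 →
      |∫ u in Metric.closedBall (0 : EuclideanSpace ℝ (Fin (N + 1))) r,
          Real.cos (inner ℝ ξ u)| ≤ K * (r ^ ((N : ℝ) / 2) * ‖ξ‖ ^ (-((N : ℝ) / 2 + 1))) := by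
  obtain ⟨K, hK0, hK⟩ := exists_poissonCos_half_le N
  set κ := volume.real (Metric.ball (0 : EuclideanSpace ℝ (Fin N)) 1) with hκ
  have hκ0 : 0 ≤ κ := measureReal_nonneg
  refine ⟨(2 * κ + 1) * K, by positivity, fun r hr ξ hξ => ?_⟩
  have hn : 0 < ‖ξ‖ := norm_pos_iff.2 hξ
  rw [integral_closedBall_cos_inner N hr ξ hξ, abs_mul, abs_mul, abs_of_pos (by positivity),
    abs_of_nonneg (by positivity : 0 ≤ 2 * κ)]
  have h1 := hK (r * ‖ξ‖) (by positivity)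
  rw [Real.mul_rpow hr.le hn.le] at h1
  have h2 : r ^ (N + 1) * r ^ (-((N : ℝ) / 2 + 1)) = r ^ ((N : ℝ) / 2) := by
    rw [← Real.rpow_natCast, ← Real.rpow_add hr]
    congr 1
    push_cast
    ring
  calc _ ≤ r ^ (N + 1) * ((2 * κ + 1) * (K * (r ^ (-((N : ℝ) / 2 + 1)) *
        ‖ξ‖ ^ (-((N : ℝ) / 2 + 1))))) := by gcongr; linarith
    _ = (2 * κ + 1) * K * ((r ^ (N + 1) * r ^ (-((N : ℝ) / 2 + 1))) *
        ‖ξ‖ ^ (-((N : ℝ) / 2 + 1))) := by ring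
    _ = _ := by rw [h2]

/-! ### A lattice sum -/

/-- An integer vector, as a point of Euclidean space. -/
noncomputable def intVec {n : ℕ} (v : Fin n → ℤ) : EuclideanSpace ℝ (Fin n) :=
  WithLp.toLp 2 fun j => (v j : ℝ)

/-- The decay `x^{-a} min(1, (δx)^{-a})`, `a = b + 1`, of the Fourier coefficients of a ball
smoothed at scale `δ`. -/
noncomputable def smoothWeight (b δ x : ℝ) : ℝ :=
  x ^ (-(b + 1)) * min 1 ((δ * x) ^ (-(b + 1)))

lemma smoothWeight_nonneg {b δ x : ℝ} (hδ : 0 ≤ δ) (hx : 0 ≤ x) : 0 ≤ smoothWeight b δ x :=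
  mul_nonneg (Real.rpow_nonneg hx _)
    (le_min zero_le_one (Real.rpow_nonneg (mul_nonneg hδ hx) _))

lemma smoothWeight_anti {b δ x y : ℝ} (hb : 0 ≤ b) (hδ : 0 < δ) (hx : 0 < x) (hxy : x ≤ y) :
    smoothWeight b δ y ≤ smoothWeight b δ x := by
  have hy : 0 < y := hx.trans_le hxy
  refine mul_le_mul (Real.rpow_le_rpow_of_nonpos hx hxy (by linarith))
    (min_le_min_left _ (Real.rpow_le_rpow_of_nonpos (by positivity) (by gcongr) (by linarith)))
    (le_min zero_le_one (Real.rpow_nonneg (by positivity) _)) (Real.rpow_nonneg hx.le _)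

lemma smoothWeight_mul {b δ q x : ℝ} (hq : 0 < q) (hx : 0 < x) :
    smoothWeight b δ (q * x) = q ^ (-(b + 1)) * smoothWeight b (δ * q) x := by
  rw [smoothWeight, smoothWeight, Real.mul_rpow hq.le hx.le, mul_assoc, mul_assoc]

/-- One dyadic term is dominated by a difference of the bounded function `-1 / (1 + √y)`. -/
lemma rpow_mul_min_le {b y : ℝ} (hb : 1 / 2 ≤ b) (hy : 0 < y) :
    y ^ b * min 1 (y ^ (-(b + 1))) ≤ 13 * (1 / (1 + √y) - 1 / (1 + √(2 * y))) := by
  obtain ⟨z, hz⟩ : ∃ z, z = √y := ⟨_, rfl⟩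
  have hz0 : 0 < z := by rw [hz]; exact Real.sqrt_pos.2 hy
  -- With `z = √y` and `w = √2` the left side is at most `min z (1 / z)`, as `b ≥ 1 / 2`.
  obtain ⟨w, hw⟩ : ∃ w, w = √(2 : ℝ) := ⟨_, rfl⟩
  have hw2 : w ^ 2 = 2 := by rw [hw]; exact Real.sq_sqrt (by norm_num)
  have hw0 : 0 ≤ w := by rw [hw]; exact Real.sqrt_nonneg _
  have hw1 : 1.4 ≤ w := by nlinarith
  have hw3 : w ≤ 1.5 := by nlinarith
  rw [Real.sqrt_mul (by norm_num), ← hz, ← hw]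
  have hkey : 1 / (1 + z) - 1 / (1 + w * z) = (w - 1) * z / ((1 + z) * (1 + w * z)) := by
    field_simp
    ring
  have hwz : 0 < 1 + w * z := by positivity
  rw [hkey]
  rcases le_total y 1 with h | h
  · have hz1 : z ≤ 1 := by rw [hz]; exact Real.sqrt_le_one.2 h
    have h1 : y ^ b ≤ z := by
      rw [hz, Real.sqrt_eq_rpow]
      exact Real.rpow_le_rpow_of_exponent_ge hy h hb
    have h2 : z ≤ 13 * ((w - 1) * z / ((1 + z) * (1 + w * z))) := by
      rw [mul_div_assoc', le_div_iff₀ (by positivity)]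
      have : (1 + z) * (1 + w * z) ≤ 5 := by nlinarith
      nlinarith
    calc _ ≤ y ^ b * 1 := by gcongr; exact min_le_left _ _
      _ ≤ _ := by rw [mul_one]; exact h1.trans h2
  · have hz1 : 1 ≤ z := by rw [hz]; exact Real.one_le_sqrt.2 h
    have h1 : y ^ b * y ^ (-(b + 1)) ≤ 1 / z := by
      rw [← Real.rpow_add hy, show b + -(b + 1) = -1 by ring, Real.rpow_neg_one, one_div]
      refine inv_anti₀ hz0 ?_
      have : z ^ 2 = y := by rw [hz]; exact Real.sq_sqrt hy.le
      nlinarith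
    have h2 : 1 / z ≤ 13 * ((w - 1) * z / ((1 + z) * (1 + w * z))) := by
      rw [mul_div_assoc', div_le_div_iff₀ hz0 (by positivity)]
      have : (1 + z) * (1 + w * z) ≤ (2 * z) * (2.5 * z) := by
        apply mul_le_mul <;> nlinarith
      nlinarith
    calc _ ≤ y ^ b * y ^ (-(b + 1)) := by gcongr; exact min_le_right _ _
      _ ≤ _ := h1.trans h2

/-- The factor `(2^j)^{2b+1}` is the order of the number of lattice points of size about `2^j` in
dimension `2b + 1`. The sum telescopes after `rpow_mul_min_le` with `y = δ 2^j`. -/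
lemma sum_dyadic_smoothWeight_le {b δ : ℝ} (hb : 1 / 2 ≤ b) (hδ : 0 < δ) (J : ℕ) :
    ∑ j ∈ Finset.range J, ((2 : ℝ) ^ j) ^ (2 * b + 1) * smoothWeight b δ (2 ^ j) ≤
      13 * δ ^ (-b) := by
  have hterm : ∀ j : ℕ, ((2 : ℝ) ^ j) ^ (2 * b + 1) * smoothWeight b δ (2 ^ j) ≤
      δ ^ (-b) * 13 * (1 / (1 + √(δ * 2 ^ j)) - 1 / (1 + √(δ * 2 ^ (j + 1)))) := by
    intro j
    have hx : (0 : ℝ) < 2 ^ j := by positivity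
    have h := rpow_mul_min_le hb (mul_pos hδ hx)
    have e1 : 2 * (δ * 2 ^ j) = δ * 2 ^ (j + 1) := by ring
    rw [e1] at h
    have e2 : ((2 : ℝ) ^ j) ^ (2 * b + 1) * smoothWeight b δ (2 ^ j) =
        δ ^ (-b) * ((δ * 2 ^ j) ^ b * min 1 ((δ * 2 ^ j) ^ (-(b + 1)))) := by
      have e3 : δ ^ (-b) * (δ * 2 ^ j) ^ b = (2 ^ j) ^ b := by
        rw [Real.mul_rpow hδ.le hx.le, ← mul_assoc, ← Real.rpow_add hδ, neg_add_cancel,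
          Real.rpow_zero, one_mul]
      rw [smoothWeight, ← mul_assoc, ← mul_assoc, ← Real.rpow_add hx, e3]
      congr 2
      ring
    rw [e2, mul_assoc]
    gcongr
  calc _ ≤ ∑ j ∈ Finset.range J,
        δ ^ (-b) * 13 * (1 / (1 + √(δ * 2 ^ j)) - 1 / (1 + √(δ * 2 ^ (j + 1)))) :=
        Finset.sum_le_sum fun j _ => hterm j
    _ = δ ^ (-b) * 13 * (1 / (1 + √(δ * 2 ^ 0)) - 1 / (1 + √(δ * 2 ^ J))) := by
        rw [← Finset.mul_sum, Finset.sum_range_sub' (fun j => 1 / (1 + √(δ * 2 ^ j)))]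
    _ ≤ δ ^ (-b) * 13 * 1 := by
        gcongr
        have h1 : 1 / (1 + √(δ * 2 ^ 0)) ≤ 1 := by
          rw [div_le_one (by positivity)]
          linarith [Real.sqrt_nonneg (δ * 2 ^ 0)]
        have h2 : 0 ≤ 1 / (1 + √(δ * 2 ^ J)) := by positivity
        linarith
    _ = _ := by ring

/-- The largest absolute value of a coordinate. -/
def supNatAbs {n : ℕ} (v : Fin n → ℤ) : ℕ := Finset.univ.sup fun j => (v j).natAbs

lemma supNatAbs_pos {n : ℕ} {v : Fin n → ℤ} (hv : v ≠ 0) : 0 < supNatAbs v := by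
  obtain ⟨j, hj⟩ := Function.ne_iff.1 hv
  exact (Int.natAbs_pos.2 hj).trans_le (Finset.le_sup (f := fun j => (v j).natAbs)
    (Finset.mem_univ j))

lemma supNatAbs_le_norm {n : ℕ} {v : Fin n → ℤ} (hv : v ≠ 0) :
    (supNatAbs v : ℝ) ≤ ‖intVec v‖ := by
  obtain ⟨i, _⟩ := Function.ne_iff.1 hv
  obtain ⟨j, _, hj⟩ := Finset.exists_mem_eq_sup Finset.univ ⟨i, Finset.mem_univ i⟩
    fun j => (v j).natAbs
  rw [supNatAbs, hj, Nat.cast_natAbs, Int.cast_abs]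
  exact PiLp.norm_apply_le (intVec v) j

lemma card_filter_log_supNatAbs_le {n : ℕ} (s : Finset (Fin n → ℤ)) (j : ℕ) :
    ((s.filter fun v => Nat.log 2 (supNatAbs v) = j).card : ℝ) ≤ (5 * 2 ^ j) ^ n := by
  have hsub : (s.filter fun v => Nat.log 2 (supNatAbs v) = j) ⊆
      Fintype.piFinset fun _ : Fin n => Finset.Icc (-(2 : ℤ) ^ (j + 1)) (2 ^ (j + 1)) := by
    intro v hv
    rw [Finset.mem_filter] at hv
    rw [Fintype.mem_piFinset]
    intro i
    have h1 : supNatAbs v < 2 ^ (j + 1) := by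
      have := Nat.lt_pow_succ_log_self one_lt_two (supNatAbs v)
      rwa [hv.2] at this
    have h2 : (v i).natAbs < 2 ^ (j + 1) :=
      (Finset.le_sup (f := fun j => (v j).natAbs) (Finset.mem_univ i)).trans_lt h1
    have h3 : |v i| ≤ 2 ^ (j + 1) := by
      rw [Int.abs_eq_natAbs]
      exact_mod_cast h2.le
    rw [Finset.mem_Icc]
    exact abs_le.1 h3
  have hcard := Finset.card_le_card hsub
  rw [Fintype.card_piFinset, Finset.prod_const, Finset.card_univ, Fintype.card_fin,
    Int.card_Icc] at hcard
  have h5 : (2 ^ (j + 1) + 1 - -(2 : ℤ) ^ (j + 1)).toNat ≤ 5 * 2 ^ j := by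
    rw [Int.toNat_le]
    have : (1 : ℤ) ≤ 2 ^ j := one_le_pow₀ (by norm_num)
    push_cast
    rw [pow_succ]
    linarith
  exact_mod_cast hcard.trans (Nat.pow_le_pow_left h5 n)

/-- The lattice sum of `smoothWeight` over nonzero integer vectors in dimension `2b + 1`, by
dyadic decomposition. -/
lemma sum_smoothWeight_le (N : ℕ) (hN : 1 ≤ N) {δ : ℝ} (hδ : 0 < δ)
    (s : Finset (Fin (N + 1) → ℤ)) (hs : (0 : Fin (N + 1) → ℤ) ∉ s) :
    ∑ v ∈ s, smoothWeight ((N : ℝ) / 2) δ ‖intVec v‖ ≤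
      5 ^ (N + 1) * 13 * δ ^ (-((N : ℝ) / 2)) := by
  have hb : (1 : ℝ) / 2 ≤ (N : ℝ) / 2 := by
    have : (1 : ℝ) ≤ N := by exact_mod_cast hN
    linarith
  set b : ℝ := (N : ℝ) / 2 with hbdef
  have hne : ∀ v ∈ s, v ≠ 0 := fun v hv h => hs (h ▸ hv)
  set J := s.sup (fun v => Nat.log 2 (supNatAbs v)) + 1 with hJ
  have hmaps : ∀ v ∈ s, Nat.log 2 (supNatAbs v) ∈ Finset.range J := fun v hv =>
    Finset.mem_range.2 (Nat.lt_succ_of_le (Finset.le_sup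
      (f := fun v => Nat.log 2 (supNatAbs v)) hv))
  calc _ ≤ ∑ v ∈ s, smoothWeight b δ (2 ^ Nat.log 2 (supNatAbs v)) := by
        refine Finset.sum_le_sum fun v hv => ?_
        refine smoothWeight_anti (by linarith) hδ (by positivity) ?_
        refine le_trans ?_ (supNatAbs_le_norm (hne v hv))
        exact_mod_cast Nat.pow_log_le_self 2 (supNatAbs_pos (hne v hv)).ne'
    _ = ∑ j ∈ Finset.range J, ∑ v ∈ s with Nat.log 2 (supNatAbs v) = j,
          smoothWeight b δ (2 ^ Nat.log 2 (supNatAbs v)) :=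
        (Finset.sum_fiberwise_of_maps_to hmaps _).symm
    _ = ∑ j ∈ Finset.range J, ((s.filter fun v => Nat.log 2 (supNatAbs v) = j).card : ℝ) *
          smoothWeight b δ (2 ^ j) := by
        refine Finset.sum_congr rfl fun j _ => ?_
        rw [← nsmul_eq_mul, ← Finset.sum_const]
        refine Finset.sum_congr rfl fun v hv => ?_
        rw [(Finset.mem_filter.1 hv).2]
    _ ≤ ∑ j ∈ Finset.range J,
          5 ^ (N + 1) * (((2 : ℝ) ^ j) ^ (2 * b + 1) * smoothWeight b δ (2 ^ j)) := by
        refine Finset.sum_le_sum fun j _ => ?_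
        rw [← mul_assoc]
        refine mul_le_mul_of_nonneg_right ?_ (smoothWeight_nonneg hδ.le (by positivity))
        refine (card_filter_log_supNatAbs_le s j).trans_eq ?_
        rw [mul_pow, show 2 * b + 1 = ((N + 1 : ℕ) : ℝ) by rw [hbdef]; push_cast; ring,
          Real.rpow_natCast]
    _ ≤ _ := by
        rw [← Finset.mul_sum, mul_assoc]
        gcongr
        exact sum_dyadic_smoothWeight_le hb hδ J

/-! ### Smoothed balls on the torus -/

/-- The covering map `ℝⁿ → (ℝ/ℤ)ⁿ`. -/
noncomputable def torusProj {n : ℕ} (u : EuclideanSpace ℝ (Fin n)) : UnitAddTorus (Fin n) :=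
  fun j => ((u j : ℝ) : UnitAddCircle)

lemma torusProj_add {n : ℕ} (u w : EuclideanSpace ℝ (Fin n)) :
    torusProj (u + w) = torusProj u + torusProj w := by
  ext j; simp [torusProj]

lemma torusProj_sub {n : ℕ} (u w : EuclideanSpace ℝ (Fin n)) :
    torusProj (u - w) = torusProj u - torusProj w := by
  ext j; simp [torusProj]

lemma continuous_torusProj {n : ℕ} : Continuous (torusProj (n := n)) :=
  continuous_pi fun j => (AddCircle.continuous_mk' 1).comp (by fun_prop)

lemma mem_torusBall_iff {n : ℕ} {x y : UnitAddTorus (Fin n)} {R : ℝ} :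
    x ∈ torusBall y R ↔ ∃ u : EuclideanSpace ℝ (Fin n), ‖u‖ ≤ R ∧ x - y = torusProj u := by
  refine exists_congr fun u => and_congr_right fun _ => ?_
  rw [funext_iff]
  refine forall_congr' fun j => ?_
  rw [Pi.sub_apply, torusProj, sub_eq_iff_eq_add, add_comm]

lemma mem_torusBall_iff_sub_mem {n : ℕ} {x y : UnitAddTorus (Fin n)} {R : ℝ} :
    x ∈ torusBall y R ↔ x - y ∈ torusBall 0 R := by
  simp only [mem_torusBall_iff, sub_zero]

lemma torusBall_mono {n : ℕ} {y : UnitAddTorus (Fin n)} {R R' : ℝ} (h : R ≤ R') :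
    torusBall y R ⊆ torusBall y R' := fun _ ⟨u, hu, hx⟩ => ⟨u, hu.trans h, hx⟩

lemma torusBall_zero_eq_image {n : ℕ} (R : ℝ) :
    torusBall (0 : UnitAddTorus (Fin n)) R = torusProj '' Metric.closedBall 0 R := by
  ext x
  simp only [mem_torusBall_iff, sub_zero, Set.mem_image, mem_closedBall_zero_iff, eq_comm]

lemma measurableSet_torusBall_zero {n : ℕ} (R : ℝ) :
    MeasurableSet (torusBall (0 : UnitAddTorus (Fin n)) R) := by
  rw [torusBall_zero_eq_image]
  exact ((isCompact_closedBall _ _).image continuous_torusProj).isClosed.measurableSet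

/-- A ball of radius `δ < 1/2` embeds into the torus, measure included. -/
lemma restrict_torusBall_zero {n : ℕ} {δ : ℝ} (hδ : δ < 1 / 2) :
    (volume : Measure (UnitAddTorus (Fin n))).restrict (torusBall 0 δ) =
      (volume.restrict (Metric.closedBall (0 : EuclideanSpace ℝ (Fin n)) δ)).map torusProj := by
  have hq : MeasurePreserving (fun (x : Fin n → ℝ) (j : Fin n) => (x j : UnitAddCircle))
      (volume.restrict (Set.univ.pi fun _ => Set.Ioc (-(1 / 2)) (-(1 / 2) + 1))) volume := by
    have := measurePreserving_pi (ι := Fin n) (fun _ => volume.restrict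
      (Set.Ioc (-(1 / 2) : ℝ) (-(1 / 2) + 1))) (fun _ => (volume : Measure UnitAddCircle))
      (fun _ => UnitAddCircle.measurePreserving_mk (-(1 / 2)))
    rwa [← Measure.restrict_pi_pi] at this
  ext S hS
  have hSA := hS.inter (measurableSet_torusBall_zero (n := n) δ)
  have hcube : MeasurableSet (Set.univ.pi fun _ : Fin n => Set.Ioc (-(1 / 2) : ℝ) (-(1 / 2) + 1)) :=
    MeasurableSet.univ_pi fun _ => measurableSet_Ioc
  rw [Measure.restrict_apply hS, Measure.map_apply continuous_torusProj.measurable hS,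
    Measure.restrict_apply (continuous_torusProj.measurable hS), ← hq.measure_preimage
      hSA.nullMeasurableSet, Measure.restrict_apply (hq.measurable hSA),
    ← (PiLp.volume_preserving_ofLp (Fin n)).measure_preimage
      ((hq.measurable hSA).inter hcube).nullMeasurableSet]
  congr 1
  ext u
  simp only [Set.mem_preimage, Set.mem_inter_iff, Set.mem_univ_pi, mem_closedBall_zero_iff]
  have hcoord : ∀ w : EuclideanSpace ℝ (Fin n), ‖w‖ ≤ δ → ∀ j, |w j| < 1 / 2 := fun w hw j =>
    ((PiLp.norm_apply_le w j).trans hw).trans_lt hδ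
  -- Points of the cube `(-1/2, 1/2]ⁿ` are determined by their class, so a point of the cube lying
  -- over the ball belongs to the ball itself.
  constructor
  · rintro ⟨⟨h1, h2⟩, h3⟩
    refine ⟨h1, ?_⟩
    obtain ⟨w, hw, hw'⟩ := mem_torusBall_iff.1 h2
    rw [sub_zero] at hw'
    have : w = u := by
      ext j
      have := abs_lt.1 (hcoord w hw j)
      exact (AddCircle.coe_eq_coe_iff_of_mem_Ioc (p := (1 : ℝ)) ⟨this.1, by linarith [this.2]⟩
        (h3 j)).1 (congrFun hw' j).symm
    rwa [← this]
  · rintro ⟨h1, h2⟩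
    refine ⟨⟨h1, mem_torusBall_iff.2 ⟨u, h2, sub_zero _⟩⟩, fun j => ?_⟩
    have := abs_lt.1 (hcoord u h2 j)
    exact ⟨this.1, by linarith [this.2]⟩

lemma volume_torusBall_zero {n : ℕ} {δ : ℝ} (hδ : δ < 1 / 2) :
    (volume : Measure (UnitAddTorus (Fin n))) (torusBall 0 δ) =
      volume (Metric.closedBall (0 : EuclideanSpace ℝ (Fin n)) δ) := by
  have := congrArg (fun μ => μ Set.univ) (restrict_torusBall_zero (n := n) hδ)
  simpa [Measure.map_apply continuous_torusProj.measurable] using this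

lemma volume_torusBall {n : ℕ} (y : UnitAddTorus (Fin n)) {δ : ℝ} (hδ : δ < 1 / 2) :
    (volume : Measure (UnitAddTorus (Fin n))) (torusBall y δ) =
      volume (Metric.closedBall (0 : EuclideanSpace ℝ (Fin n)) δ) := by
  rw [← volume_torusBall_zero hδ]
  have : torusBall y δ = (fun x => x - y) ⁻¹' torusBall 0 δ := by
    ext x; exact mem_torusBall_iff_sub_mem
  simp only [this, sub_eq_add_neg]
  exact measure_preimage_add_right _ _ _

/-- The self-overlap `μ(A ∩ (A - z))` of a set, i.e. the autocorrelation of its indicator. -/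
noncomputable def selfOverlap {G : Type*} [AddGroup G] [MeasureSpace G] (A : Set G) (z : G) :
    ENNReal :=
  volume (A ∩ (fun t => t + z) ⁻¹' A)

lemma measurable_selfOverlap {G : Type*} [AddCommGroup G] [MeasureSpace G] [MeasurableAdd₂ G]
    [SFinite (volume : Measure G)] {A : Set G} (hA : MeasurableSet A) :
    Measurable (selfOverlap A) := by
  have h : MeasurableSet {q : G × G | q.2 ∈ A ∧ q.2 + q.1 ∈ A} :=
    (measurable_snd hA).inter ((measurable_snd.add measurable_fst) hA)
  exact measurable_measure_prodMk_left h

/-- The total mass of an autocorrelation, by Fubini's theorem. -/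
lemma lintegral_selfOverlap {G : Type*} [AddCommGroup G] [MeasureSpace G] [MeasurableAdd₂ G]
    [SFinite (volume : Measure G)] [(volume : Measure G).IsAddLeftInvariant] {A : Set G}
    (hA : MeasurableSet A) : ∫⁻ z, selfOverlap A z = volume A * volume A := by
  have h1 : MeasurableSet {q : G × G | q.2 ∈ A ∧ q.2 + q.1 ∈ A} :=
    (measurable_snd hA).inter ((measurable_snd.add measurable_fst) hA)
  have h2 := Measure.prod_apply (μ := (volume : Measure G)) (ν := (volume : Measure G)) h1
  rw [Measure.prod_apply_symm h1] at h2
  have h3 : ∫⁻ z, selfOverlap A z = ∫⁻ t : G, volume ((fun z : G => (z, t)) ⁻¹'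
      {q : G × G | q.2 ∈ A ∧ q.2 + q.1 ∈ A}) := h2.symm
  rw [h3]
  have h4 : ∀ t : G, volume ((fun z : G => (z, t)) ⁻¹' {q : G × G | q.2 ∈ A ∧ q.2 + q.1 ∈ A}) =
      A.indicator (fun _ => volume A) t := by
    intro t
    by_cases ht : t ∈ A
    · rw [Set.indicator_of_mem ht, ← measure_preimage_add volume t A]
      congr 1
      ext z
      simp [ht]
    · rw [Set.indicator_of_notMem ht]
      simp [ht]
  simp only [h4]
  rw [lintegral_indicator_const hA]

/-- The ball of radius `r`, pushed to the torus and smoothed by the self-overlap of the ball of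
radius `δ`, at the point `x`. -/
noncomputable def smoothedBall {n : ℕ} (δ r : ℝ) (x : UnitAddTorus (Fin n)) : ENNReal :=
  ∫⁻ u in Metric.closedBall (0 : EuclideanSpace ℝ (Fin n)) r,
    selfOverlap (torusBall 0 δ) (x - torusProj u)

/-- Self-overlaps can only grow when passing to the torus. -/
lemma selfOverlap_closedBall_le {n : ℕ} {δ : ℝ} (hδ : δ < 1 / 2)
    (s : EuclideanSpace ℝ (Fin n)) :
    selfOverlap (Metric.closedBall (0 : EuclideanSpace ℝ (Fin n)) δ) s ≤
      selfOverlap (torusBall 0 δ) (torusProj s) := by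
  have hm : MeasurableSet ((fun t => t + torusProj s) ⁻¹' torusBall (0 : UnitAddTorus (Fin n)) δ) :=
    (measurable_add_const _) (measurableSet_torusBall_zero δ)
  rw [selfOverlap, selfOverlap, Set.inter_comm (torusBall 0 δ), ← Measure.restrict_apply hm,
    restrict_torusBall_zero hδ, Measure.map_apply continuous_torusProj.measurable hm,
    Measure.restrict_apply (continuous_torusProj.measurable hm), Set.inter_comm]
  refine measure_mono (Set.inter_subset_inter_left _ fun t ht => ?_)
  simp only [Set.mem_preimage, ← torusProj_add]
  exact mem_torusBall_iff.2 ⟨t + s, mem_closedBall_zero_iff.1 ht, sub_zero _⟩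

/-- The smoothed ball of radius `R + 2δ` majorizes the ball of radius `R`. -/
lemma le_smoothedBall {n : ℕ} {δ R : ℝ} (hδ : δ < 1 / 2) {x : UnitAddTorus (Fin n)}
    (hx : x ∈ torusBall 0 R) :
    volume (Metric.closedBall (0 : EuclideanSpace ℝ (Fin n)) δ) *
      volume (Metric.closedBall (0 : EuclideanSpace ℝ (Fin n)) δ) ≤
        smoothedBall δ (R + 2 * δ) x := by
  obtain ⟨w, hw, hwx⟩ := mem_torusBall_iff.1 hx
  rw [sub_zero] at hwx
  rw [← lintegral_selfOverlap measurableSet_closedBall,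
    ← lintegral_sub_left_eq_self _ w, smoothedBall, ← lintegral_indicator measurableSet_closedBall]
  refine lintegral_mono fun u => ?_
  by_cases hu : u ∈ Metric.closedBall (0 : EuclideanSpace ℝ (Fin n)) (R + 2 * δ)
  · rw [Set.indicator_of_mem hu, hwx, ← torusProj_sub]
    exact selfOverlap_closedBall_le hδ _
  · rw [Set.indicator_of_notMem hu, nonpos_iff_eq_zero, selfOverlap]
    refine (congrArg _ ?_).trans measure_empty
    rw [Set.eq_empty_iff_forall_notMem]
    rintro t ⟨ht1, ht2⟩
    simp only [Set.mem_preimage, mem_closedBall_zero_iff] at ht1 ht2 hu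
    refine hu ?_
    have e : u = w + t - (t + (w - u)) := by abel
    rw [e]
    calc _ ≤ ‖w‖ + ‖t‖ + ‖t + (w - u)‖ := (norm_sub_le _ _).trans (by gcongr; exact norm_add_le _ _)
      _ ≤ _ := by linarith

/-- As the ball of radius `r < 1/2` embeds into the torus, smoothing it gives at most what smoothing
the whole torus gives. -/
lemma smoothedBall_le {n : ℕ} {δ r : ℝ} (hδ : δ < 1 / 2) (hr : r < 1 / 2)
    (x : UnitAddTorus (Fin n)) :
    smoothedBall δ r x ≤ volume (Metric.closedBall (0 : EuclideanSpace ℝ (Fin n)) δ) *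
      volume (Metric.closedBall (0 : EuclideanSpace ℝ (Fin n)) δ) := by
  have hm := measurable_selfOverlap (measurableSet_torusBall_zero (n := n) δ)
  have : (volume : Measure (UnitAddTorus (Fin n))).IsNegInvariant :=
    Measure.IsAddHaarMeasure.isNegInvariant_of_regular _
  rw [← volume_torusBall_zero hδ, ← lintegral_selfOverlap (measurableSet_torusBall_zero δ),
    ← lintegral_sub_left_eq_self _ x, smoothedBall,
    ← lintegral_map (f := fun t => selfOverlap (torusBall 0 δ) (x - t))
      (hm.comp (measurable_id.const_sub x)) continuous_torusProj.measurable,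
    ← restrict_torusBall_zero hr]
  exact setLIntegral_le_lintegral _ _

/-- Smoothing at scale `δ` enlarges the support by `2δ`. -/
lemma smoothedBall_eq_zero {n : ℕ} {δ r : ℝ} {x : UnitAddTorus (Fin n)}
    (hx : x ∉ torusBall 0 (r + 2 * δ)) : smoothedBall δ r x = 0 := by
  rw [smoothedBall, setLIntegral_congr_fun (g := fun _ => 0) measurableSet_closedBall,
    lintegral_zero]
  intro u hu
  simp only
  rw [selfOverlap]
  refine (congrArg _ ?_).trans measure_empty
  rw [Set.eq_empty_iff_forall_notMem]
  rintro t ⟨ht1, ht2⟩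
  rw [Set.mem_preimage] at ht2
  obtain ⟨a, ha, ha'⟩ := mem_torusBall_iff.1 ht1
  obtain ⟨c, hc, hc'⟩ := mem_torusBall_iff.1 ht2
  rw [mem_closedBall_zero_iff] at hu
  refine hx (mem_torusBall_iff.2 ⟨u + c - a, ?_, ?_⟩)
  · calc _ ≤ ‖u‖ + ‖c‖ + ‖a‖ := (norm_sub_le _ _).trans (by gcongr; exact norm_add_le _ _)
      _ ≤ _ := by linarith
  · rw [torusProj_sub, torusProj_add, ← ha', ← hc']
    abel

/-! ### Fourier expansions of smoothed balls -/

/-- On each circle of circumference `1`, `volume` is the normalized Haar measure. -/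
lemma volume_unitAddTorus_eq_pi (n : ℕ) : (volume : Measure (UnitAddTorus (Fin n))) =
    Measure.pi fun _ => (AddCircle.haarAddCircle : Measure UnitAddCircle) := by
  rw [volume_pi]
  congr 1
  funext _
  rw [AddCircle.volume_eq_smul_haarAddCircle, ENNReal.ofReal_one, one_smul]

/-- Parseval's identity on the torus for the global `volume`, which is equal, but not by definition,
to the product of normalized Haar measures in `UnitAddTorus.hasSum_prod_mFourierCoeff`. -/
lemma hasSum_conj_mFourier_mul {n : ℕ} {f g : UnitAddTorus (Fin n) → ℂ}
    (hf : MemLp f 2 volume) (hg : MemLp g 2 volume) :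
    HasSum (fun v : Fin n → ℤ => (starRingEnd ℂ) (∫ t, UnitAddTorus.mFourier (-v) t * f t) *
      ∫ t, UnitAddTorus.mFourier (-v) t * g t) (∫ t, (starRingEnd ℂ) (f t) * g t) := by
  rw [volume_unitAddTorus_eq_pi] at *
  have h := UnitAddTorus.hasSum_prod_mFourierCoeff (hf.toLp f) (hg.toLp g)
  have e : ∀ (f : UnitAddTorus (Fin n) → ℂ) (hf : MemLp f 2 (Measure.pi fun _ =>
      (AddCircle.haarAddCircle : Measure UnitAddCircle))) (v : Fin n → ℤ),
      UnitAddTorus.mFourierCoeff (hf.toLp f) v = ∫ t, UnitAddTorus.mFourier (-v) t * f t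
        ∂(Measure.pi fun _ => (AddCircle.haarAddCircle : Measure UnitAddCircle)) := by
    intro f hf v
    refine integral_congr_ae ?_
    filter_upwards [hf.coeFn_toLp] with t ht
    rw [ht, smul_eq_mul]
  simp only [e] at h
  convert! h using 1
  refine integral_congr_ae ?_
  filter_upwards [hf.coeFn_toLp, hg.coeFn_toLp] with t h1 h2
  rw [h1, h2]

lemma mFourier_add_apply {n : ℕ} (v : Fin n → ℤ) (x y : UnitAddTorus (Fin n)) :
    UnitAddTorus.mFourier v (x + y) = UnitAddTorus.mFourier v x * UnitAddTorus.mFourier v y := by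
  simp only [UnitAddTorus.mFourier, ContinuousMap.coe_mk, Pi.add_apply, fourier_apply, smul_add,
    AddCircle.toCircle_add, Circle.coe_mul, Finset.prod_mul_distrib]

lemma mFourier_neg_apply {n : ℕ} (v : Fin n → ℤ) (x : UnitAddTorus (Fin n)) :
    UnitAddTorus.mFourier v (-x) = UnitAddTorus.mFourier (-v) x := by
  simp [UnitAddTorus.mFourier, fourier_apply]

lemma norm_mFourier_apply {n : ℕ} (v : Fin n → ℤ) (x : UnitAddTorus (Fin n)) :
    ‖UnitAddTorus.mFourier v x‖ = 1 := by
  simp only [UnitAddTorus.mFourier, fourier_apply, ContinuousMap.coe_mk, norm_prod]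
  exact Finset.prod_eq_one fun _ _ => Circle.norm_coe _

/-- The Fourier coefficient at `v` of the ball of radius `r` pushed to the torus. -/
noncomputable def ballCoeff {n : ℕ} (r : ℝ) (v : Fin n → ℤ) : ℂ :=
  ∫ u in Metric.closedBall (0 : EuclideanSpace ℝ (Fin n)) r,
    UnitAddTorus.mFourier (-v) (torusProj u)

lemma setIntegral_torusBall_zero {n : ℕ} {δ : ℝ} (hδ : δ < 1 / 2) (v : Fin n → ℤ) :
    ∫ t in torusBall (0 : UnitAddTorus (Fin n)) δ, UnitAddTorus.mFourier (-v) t =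
      ballCoeff δ v := by
  rw [restrict_torusBall_zero hδ, integral_map continuous_torusProj.aemeasurable
    (UnitAddTorus.mFourier (-v)).continuous.aestronglyMeasurable, ballCoeff]

/-- The Fourier expansion of the self-overlap of a ball, valid at every point. -/
lemma hasSum_selfOverlap {n : ℕ} {δ : ℝ} (hδ : δ < 1 / 2) (z : UnitAddTorus (Fin n)) :
    HasSum (fun v : Fin n → ℤ => ((‖ballCoeff δ v‖ ^ 2 : ℝ) : ℂ) * UnitAddTorus.mFourier v z)
      (((selfOverlap (torusBall 0 δ) z).toReal : ℝ) : ℂ) := by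
  set A : Set (UnitAddTorus (Fin n)) := torusBall 0 δ with hA
  have hAm : MeasurableSet A := measurableSet_torusBall_zero δ
  have hAm' : MeasurableSet ((fun t => t + z) ⁻¹' A) := (measurable_add_const z) hAm
  have hL : ∀ {S : Set (UnitAddTorus (Fin n))}, MeasurableSet S →
      MemLp (S.indicator fun _ => (1 : ℂ)) 2 volume := fun hS =>
    memLp_indicator_const 2 hS 1 (Or.inr (measure_ne_top _ _))
  have h := hasSum_conj_mFourier_mul (hL hAm) (hL hAm')
  have e0 : ∀ (S : Set (UnitAddTorus (Fin n))) (hS : MeasurableSet S) (v : Fin n → ℤ),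
      ∫ t, UnitAddTorus.mFourier (-v) t * S.indicator (fun _ => (1 : ℂ)) t =
        ∫ t in S, UnitAddTorus.mFourier (-v) t := by
    intro S hS v
    rw [← integral_indicator hS]
    refine integral_congr_ae (Filter.Eventually.of_forall fun t => ?_)
    by_cases ht : t ∈ S <;> simp [ht]
  have e1 : ∀ v : Fin n → ℤ, ∫ t in A, UnitAddTorus.mFourier (-v) t = ballCoeff δ v :=
    setIntegral_torusBall_zero hδ
  have e2 : ∀ v : Fin n → ℤ, ∫ t in (fun t => t + z) ⁻¹' A, UnitAddTorus.mFourier (-v) t =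
      UnitAddTorus.mFourier v z * ballCoeff δ v := by
    intro v
    rw [← e1, ← integral_indicator hAm', ← integral_indicator hAm, ← integral_const_mul,
      ← integral_add_right_eq_self (μ := volume) (fun t => UnitAddTorus.mFourier v z *
        A.indicator (fun t => UnitAddTorus.mFourier (-v) t) t) z]
    refine integral_congr_ae (Filter.Eventually.of_forall fun t => ?_)
    by_cases ht : t + z ∈ A
    · have hz : UnitAddTorus.mFourier v z * UnitAddTorus.mFourier (-v) z = 1 := by
        rw [← UnitAddTorus.mFourier_add, add_neg_cancel, UnitAddTorus.mFourier_zero]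
        rfl
      simp only [Set.indicator, Set.mem_preimage, ht, if_true, mFourier_add_apply]
      linear_combination (-UnitAddTorus.mFourier (-v) t) * hz
    · simp [Set.indicator, ht]
  have e3 : ∫ t, (starRingEnd ℂ) (A.indicator (fun _ => (1 : ℂ)) t) *
      ((fun t => t + z) ⁻¹' A).indicator (fun _ => (1 : ℂ)) t =
        (((selfOverlap A z).toReal : ℝ) : ℂ) := by
    have : ∀ t, (starRingEnd ℂ) (A.indicator (fun _ => (1 : ℂ)) t) *
        ((fun t => t + z) ⁻¹' A).indicator (fun _ => (1 : ℂ)) t =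
        (A ∩ (fun t => t + z) ⁻¹' A).indicator (fun _ => (1 : ℂ)) t := by
      intro t
      by_cases h1 : t ∈ A <;> by_cases h2 : t + z ∈ A <;> simp [Set.indicator, h1, h2]
    simp only [this]
    rw [integral_indicator_const _ (hAm.inter hAm')]
    simp [selfOverlap, Measure.real]
  rw [e3] at h
  refine h.congr_fun fun v => ?_
  rw [e0 _ hAm, e0 _ hAm', e1, e2]
  push_cast
  rw [← Complex.conj_mul']
  ring

/-- The Fourier expansion of a smoothed ball, valid at every point: the expansion of the
self-overlap converges absolutely, hence can be integrated termwise. -/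
lemma hasSum_smoothedBall {n : ℕ} {δ : ℝ} (hδ : δ < 1 / 2) (r : ℝ) (x : UnitAddTorus (Fin n)) :
    HasSum (fun v : Fin n → ℤ => ((‖ballCoeff δ v‖ ^ 2 : ℝ) : ℂ) * ballCoeff r v *
      UnitAddTorus.mFourier v x) (((smoothedBall δ r x).toReal : ℝ) : ℂ) := by
  set B := Metric.closedBall (0 : EuclideanSpace ℝ (Fin n)) r with hB
  have hBfin : IsFiniteMeasure (volume.restrict B) :=
    ⟨by simpa using (measure_closedBall_lt_top : volume B < ⊤)⟩
  have hsummable : Summable fun v : Fin n → ℤ => ‖ballCoeff δ v‖ ^ 2 := by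
    have := (hasSum_selfOverlap hδ (0 : UnitAddTorus (Fin n))).summable.norm
    simpa [norm_mFourier_apply] using this
  have hcont : ∀ v : Fin n → ℤ, Continuous fun u : EuclideanSpace ℝ (Fin n) =>
      ((‖ballCoeff δ v‖ ^ 2 : ℝ) : ℂ) * UnitAddTorus.mFourier v (x - torusProj u) := fun v =>
    continuous_const.mul ((UnitAddTorus.mFourier v).continuous.comp
      (continuous_const.sub continuous_torusProj))
  have hnorm : ∀ (v : Fin n → ℤ) (u : EuclideanSpace ℝ (Fin n)),
      ‖((‖ballCoeff δ v‖ ^ 2 : ℝ) : ℂ) * UnitAddTorus.mFourier v (x - torusProj u)‖ =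
        ‖ballCoeff δ v‖ ^ 2 := by
    intro v u
    rw [norm_mul, norm_mFourier_apply, mul_one, Complex.norm_real,
      Real.norm_of_nonneg (sq_nonneg _)]
  have h := hasSum_integral_of_summable_integral_norm (μ := volume.restrict B)
    (F := fun (v : Fin n → ℤ) u =>
      ((‖ballCoeff δ v‖ ^ 2 : ℝ) : ℂ) * UnitAddTorus.mFourier v (x - torusProj u))
    (fun v => (integrable_const (‖ballCoeff δ v‖ ^ 2)).mono'
      (hcont v).aestronglyMeasurable (Filter.Eventually.of_forall fun u => (hnorm v u).le))
    (by
      simp only [hnorm, integral_const]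
      exact hsummable.const_smul _)
  have e1 : ∫ u in B, ∑' v : Fin n → ℤ,
      ((‖ballCoeff δ v‖ ^ 2 : ℝ) : ℂ) * UnitAddTorus.mFourier v (x - torusProj u) =
        (((smoothedBall δ r x).toReal : ℝ) : ℂ) := by
    simp only [fun z => (hasSum_selfOverlap (n := n) hδ z).tsum_eq]
    rw [integral_complex_ofReal, integral_toReal, smoothedBall]
    · exact ((measurable_selfOverlap (measurableSet_torusBall_zero δ)).comp
        (continuous_const.sub continuous_torusProj).measurable).aemeasurable
    · exact Filter.Eventually.of_forall fun u => measure_lt_top _ _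
  rw [e1] at h
  refine h.congr_fun fun v => ?_
  rw [integral_const_mul, mul_assoc]
  congr 1
  rw [ballCoeff, ← integral_mul_const]
  refine integral_congr_ae (Filter.Eventually.of_forall fun u => ?_)
  simp only [sub_eq_add_neg, mFourier_add_apply, mFourier_neg_apply]
  ring

lemma mFourier_torusProj {n : ℕ} (v : Fin n → ℤ) (u : EuclideanSpace ℝ (Fin n)) :
    UnitAddTorus.mFourier v (torusProj u) =
      Complex.exp ((inner ℝ ((2 * Real.pi) • intVec v) u : ℝ) * Complex.I) := by
  rw [inner_smul_left, PiLp.inner_apply]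
  simp only [UnitAddTorus.mFourier, ContinuousMap.coe_mk, torusProj, fourier_coe_apply]
  rw [← Complex.exp_sum]
  congr 1
  simp only [intVec, RCLike.inner_apply, conj_trivial]
  push_cast
  rw [Finset.mul_sum, Finset.sum_mul]
  refine Finset.sum_congr rfl fun j _ => ?_
  ring

/-- The sine part vanishes because the ball is symmetric. -/
lemma ballCoeff_eq_integral_cos {n : ℕ} (r : ℝ) (v : Fin n → ℤ) :
    ballCoeff r v = ((∫ u in Metric.closedBall (0 : EuclideanSpace ℝ (Fin n)) r,
      Real.cos (inner ℝ ((2 * Real.pi) • intVec v) u) : ℝ) : ℂ) := by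
  set ξ := (2 * Real.pi) • intVec v with hξ
  set B := Metric.closedBall (0 : EuclideanSpace ℝ (Fin n)) r with hB
  have hint : ∀ (f : EuclideanSpace ℝ (Fin n) → ℂ), Continuous f → IntegrableOn f B := fun f hf =>
    hf.continuousOn.integrableOn_compact (isCompact_closedBall _ _)
  have hflip : ballCoeff r v = ∫ u in B, UnitAddTorus.mFourier v (torusProj u) := by
    rw [ballCoeff, ← integral_indicator measurableSet_closedBall,
      ← integral_indicator measurableSet_closedBall, ← integral_neg_eq_self]
    refine integral_congr_ae (Filter.Eventually.of_forall fun u => ?_)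
    have hu : -u ∈ B ↔ u ∈ B := by simp [hB]
    have hp : torusProj (-u) = -torusProj u := by
      ext j; simp [torusProj]
    by_cases h : u ∈ B
    · simp only [Set.indicator, hu, h, if_true, ← hB, hp, ← mFourier_neg_apply, neg_neg]
    · simp only [Set.indicator, hu, h, if_false, ← hB]
  have hc : Continuous fun u : EuclideanSpace ℝ (Fin n) =>
      UnitAddTorus.mFourier v (torusProj u) :=
    (UnitAddTorus.mFourier v).continuous.comp continuous_torusProj
  have hc' : Continuous fun u : EuclideanSpace ℝ (Fin n) =>
      UnitAddTorus.mFourier (-v) (torusProj u) :=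
    (UnitAddTorus.mFourier (-v)).continuous.comp continuous_torusProj
  have hsum : ballCoeff r v + ballCoeff r v = 2 * ((∫ u in B, Real.cos (inner ℝ ξ u) : ℝ) : ℂ) := by
    nth_rw 2 [hflip]
    rw [ballCoeff, ← integral_add (hint _ hc') (hint _ hc), ← integral_complex_ofReal,
      ← integral_const_mul]
    refine integral_congr_ae (Filter.Eventually.of_forall fun u => ?_)
    have hneg : (2 * Real.pi) • intVec (-v) = -ξ := by
      rw [hξ, ← smul_neg]
      congr 1
      ext j
      simp [intVec]
    simp only [mFourier_torusProj, hneg, inner_neg_left, ← hξ]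
    change _ = 2 * ((Real.cos (inner ℝ ξ u) : ℝ) : ℂ)
    rw [Complex.ofReal_cos, Complex.two_cos]
    push_cast
    ring
  linear_combination hsum / 2

lemma intVec_ne_zero {n : ℕ} {v : Fin n → ℤ} (hv : v ≠ 0) : intVec v ≠ 0 := by
  intro h
  refine hv (funext fun j => ?_)
  have := congrArg (fun w : EuclideanSpace ℝ (Fin n) => w j) h
  simpa [intVec] using this

lemma exists_norm_ballCoeff_le (N : ℕ) :
    ∃ K : ℝ, 0 < K ∧ ∀ r : ℝ, 0 < r → ∀ v : Fin (N + 1) → ℤ, v ≠ 0 →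
      ‖ballCoeff r v‖ ≤ K * (r ^ ((N : ℝ) / 2) * ‖intVec v‖ ^ (-((N : ℝ) / 2 + 1))) := by
  obtain ⟨K, hK0, hK⟩ := exists_abs_integral_closedBall_cos_le N
  refine ⟨K, hK0, fun r hr v hv => ?_⟩
  have hv' := intVec_ne_zero hv
  have hpi : (1 : ℝ) ≤ 2 * Real.pi := by linarith [Real.pi_gt_three]
  rw [ballCoeff_eq_integral_cos, Complex.norm_real]
  refine (hK r hr _ (smul_ne_zero (by positivity) hv')).trans ?_
  refine mul_le_mul_of_nonneg_left (mul_le_mul_of_nonneg_left ?_ (by positivity)) hK0.le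
  refine Real.rpow_le_rpow_of_nonpos (norm_pos_iff.2 hv') ?_ ?_
  · rw [norm_smul, Real.norm_of_nonneg (by positivity)]
    nlinarith [norm_nonneg (intVec v)]
  · have : (0 : ℝ) ≤ N := N.cast_nonneg
    linarith

lemma norm_ballCoeff_le_volume {n : ℕ} (r : ℝ) (v : Fin n → ℤ) :
    ‖ballCoeff r v‖ ≤ volume.real (Metric.closedBall (0 : EuclideanSpace ℝ (Fin n)) r) := by
  have := norm_setIntegral_le_of_norm_le_const (μ := volume) (C := 1)
    (measure_closedBall_lt_top (x := (0 : EuclideanSpace ℝ (Fin n))) (r := r))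
    (f := fun u => UnitAddTorus.mFourier (-v) (torusProj u))
    (fun u _ => (norm_mFourier_apply _ _).le)
  simpa [ballCoeff] using this

lemma ballCoeff_zero {n : ℕ} (r : ℝ) : ballCoeff r (0 : Fin n → ℤ) =
    (volume.real (Metric.closedBall (0 : EuclideanSpace ℝ (Fin n)) r) : ℂ) := by
  simp [ballCoeff, UnitAddTorus.mFourier_zero]

/-! ### Discrepancy of a polynomial system for smoothed balls -/

lemma mFourier_torusPoint {p m n : ℕ} [Fact p.Prime]
    (G : Fin n → MvPolynomial (Fin m) (ZMod p)) (x : Fin m → ZMod p) (v : Fin n → ℤ) :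
    UnitAddTorus.mFourier v (torusPoint G x) =
      ZMod.stdAddChar (∑ j, (v j : ZMod p) * MvPolynomial.eval x (G j)) := by
  have h := map_prod (ZMod.stdAddChar (N := p)).toMonoidHom
    (fun j => Multiplicative.ofAdd ((v j : ZMod p) * MvPolynomial.eval x (G j))) Finset.univ
  rw [← ofAdd_sum] at h
  refine Eq.trans ?_ h.symm
  simp only [UnitAddTorus.mFourier, ContinuousMap.coe_mk, torusPoint, fourier_apply,
    AddChar.toMonoidHom_apply, toAdd_ofAdd]
  refine Finset.prod_congr rfl fun j _ => ?_
  rw [← zsmul_eq_mul, ZMod.stdAddChar_apply, ← map_zsmul]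
  rfl

/-- The sum of a smoothed ball over the points of a polynomial system, expanded into Weyl sums. -/
lemma hasSum_sum_smoothedBall {p m n : ℕ} [Fact p.Prime]
    (G : Fin n → MvPolynomial (Fin m) (ZMod p)) (y : UnitAddTorus (Fin n)) {δ : ℝ}
    (hδ : δ < 1 / 2) (r : ℝ) :
    HasSum (fun v : Fin n → ℤ => ((‖ballCoeff δ v‖ ^ 2 : ℝ) : ℂ) * ballCoeff r v *
      UnitAddTorus.mFourier v (-y) * weylSum G v)
      ((∑ x : Fin m → ZMod p, (smoothedBall δ r (torusPoint G x - y)).toReal : ℝ) : ℂ) := by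
  have h := hasSum_sum (s := (Finset.univ : Finset (Fin m → ZMod p)))
    fun x _ => hasSum_smoothedBall hδ r (torusPoint G x - y)
  push_cast
  push_cast at h
  refine h.congr_fun fun v => ?_
  simp only [weylSum, ← mFourier_torusPoint, sub_eq_add_neg, mFourier_add_apply]
  rw [Finset.mul_sum]
  exact Finset.sum_congr rfl fun x _ => by ring

/-- The lattice sum over nonzero vectors divisible by `q`: passing to the sublattice `qℤⁿ` gains
the factor `q^{-n}`, the inverse of its covolume. -/
lemma sum_smoothWeight_le_of_dvd (N : ℕ) (hN : 1 ≤ N) {δ : ℝ} (hδ : 0 < δ) {q : ℕ} (hq : 0 < q)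
    (s : Finset (Fin (N + 1) → ℤ)) (hs : (0 : Fin (N + 1) → ℤ) ∉ s)
    (hdvd : ∀ v ∈ s, ∀ j, (q : ℤ) ∣ v j) :
    ∑ v ∈ s, smoothWeight ((N : ℝ) / 2) δ ‖intVec v‖ ≤
      5 ^ (N + 1) * 13 * ((q : ℝ) ^ (-((N + 1 : ℕ) : ℝ)) * δ ^ (-((N : ℝ) / 2))) := by
  have hq0 : (0 : ℝ) < q := by exact_mod_cast hq
  set b : ℝ := (N : ℝ) / 2 with hb
  set quot : (Fin (N + 1) → ℤ) → (Fin (N + 1) → ℤ) := fun v j => v j / q with hquot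
  have hmul : ∀ v ∈ s, v = (q : ℤ) • quot v := fun v hv => by
    ext j
    simp only [hquot, Pi.smul_apply, smul_eq_mul]
    exact (Int.mul_ediv_cancel' (hdvd v hv j)).symm
  have hinj : Set.InjOn quot s := fun v hv w hw h => by
    rw [hmul v hv, hmul w hw, h]
  have h0 : (0 : Fin (N + 1) → ℤ) ∉ s.image quot := by
    rw [Finset.mem_image]
    rintro ⟨v, hv, hv0⟩
    refine hs ?_
    have := hmul v hv
    rw [hv0, smul_zero] at this
    rwa [← this]
  have hnorm : ∀ w : Fin (N + 1) → ℤ, ‖intVec ((q : ℤ) • w)‖ = q * ‖intVec w‖ := fun w => by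
    have : intVec ((q : ℤ) • w) = (q : ℝ) • intVec w := by
      ext j; simp [intVec]
    rw [this, norm_smul, Real.norm_of_nonneg hq0.le]
  calc ∑ v ∈ s, smoothWeight b δ ‖intVec v‖
      = ∑ v ∈ s, (q : ℝ) ^ (-(b + 1)) * smoothWeight b (δ * q) ‖intVec (quot v)‖ := by
        refine Finset.sum_congr rfl fun v hv => ?_
        have hne : quot v ≠ 0 := fun h => h0 (Finset.mem_image.2 ⟨v, hv, h⟩)
        rw [← smoothWeight_mul hq0 (norm_pos_iff.2 (intVec_ne_zero hne)), ← hnorm, ← hmul v hv]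
    _ = (q : ℝ) ^ (-(b + 1)) * ∑ w ∈ s.image quot, smoothWeight b (δ * q) ‖intVec w‖ := by
        rw [Finset.sum_image hinj, Finset.mul_sum]
    _ ≤ (q : ℝ) ^ (-(b + 1)) * (5 ^ (N + 1) * 13 * (δ * q) ^ (-b)) := by
        gcongr
        exact sum_smoothWeight_le N hN (by positivity) _ h0
    _ = _ := by
        have : (q : ℝ) ^ (-((N + 1 : ℕ) : ℝ)) = (q : ℝ) ^ (-(b + 1)) * (q : ℝ) ^ (-b) := by
          rw [← Real.rpow_add hq0]
          congr 1
          rw [hb]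
          push_cast
          ring
        rw [this, Real.mul_rpow hδ.le hq0.le]
        ring

lemma volume_real_closedBall_zero (n : ℕ) {r : ℝ} (hr : 0 ≤ r) :
    volume.real (Metric.closedBall (0 : EuclideanSpace ℝ (Fin n)) r) =
      r ^ n * volume.real (Metric.ball (0 : EuclideanSpace ℝ (Fin n)) 1) := by
  rw [Measure.addHaar_real_closedBall _ _ hr, finrank_euclideanSpace_fin]

lemma volume_real_unitBall_pos (n : ℕ) :
    0 < volume.real (Metric.ball (0 : EuclideanSpace ℝ (Fin n)) 1) :=
  ENNReal.toReal_pos (Metric.measure_ball_pos volume _ one_pos).ne' measure_ball_lt_top.ne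

/-- The decay of the Fourier coefficients of a smoothed ball. One of the two factors `ballCoeff δ v`
is bounded by the volume only: a single one already makes the coefficients summable. -/
lemma exists_norm_ballCoeff_sq_mul_le (N : ℕ) :
    ∃ K : ℝ, 0 < K ∧ ∀ δ r : ℝ, 0 < δ → 0 < r → ∀ v : Fin (N + 1) → ℤ, v ≠ 0 →
      ‖ballCoeff δ v‖ ^ 2 * ‖ballCoeff r v‖ ≤
        volume.real (Metric.closedBall (0 : EuclideanSpace ℝ (Fin (N + 1))) δ) ^ 2 *
          (K * (r ^ ((N : ℝ) / 2) * smoothWeight ((N : ℝ) / 2) δ ‖intVec v‖)) := by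
  obtain ⟨K, hK0, hK⟩ := exists_norm_ballCoeff_le N
  have hκ := volume_real_unitBall_pos (N + 1)
  set κ := volume.real (Metric.ball (0 : EuclideanSpace ℝ (Fin (N + 1))) 1)
  set M := max 1 (K / κ) with hM
  have hM1 : 1 ≤ M := le_max_left _ _
  refine ⟨M * K, by positivity, fun δ r hδ hr v hv => ?_⟩
  have hx : 0 < ‖intVec v‖ := norm_pos_iff.2 (intVec_ne_zero hv)
  set x := ‖intVec v‖
  set V := volume.real (Metric.closedBall (0 : EuclideanSpace ℝ (Fin (N + 1))) δ) with hV
  have hVκ : V = δ ^ (N + 1) * κ := volume_real_closedBall_zero (N + 1) hδ.le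
  have hV0 : 0 < V := by rw [hVκ]; positivity
  set mn := min 1 ((δ * x) ^ (-((N : ℝ) / 2 + 1))) with hmn
  have hmn0 : 0 ≤ mn := le_min zero_le_one (Real.rpow_nonneg (by positivity) _)
  have hcV : ‖ballCoeff δ v‖ ≤ V := norm_ballCoeff_le_volume δ v
  have hc : ‖ballCoeff δ v‖ ≤ V * M * mn := by
    rw [hmn, mul_min_of_nonneg _ _ (by positivity : 0 ≤ V * M), mul_one]
    refine le_min (hcV.trans (le_mul_of_one_le_right hV0.le hM1)) ((hK δ hδ v hv).trans ?_)
    have h1 : K ≤ κ * M := by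
      have : K / κ ≤ M := le_max_right _ _
      rwa [div_le_iff₀ hκ, mul_comm] at this
    have h2 : δ ^ (N + 1) * δ ^ (-((N : ℝ) / 2 + 1)) = δ ^ ((N : ℝ) / 2) := by
      rw [← Real.rpow_natCast, ← Real.rpow_add hδ]
      congr 1
      push_cast
      ring
    calc _ ≤ κ * M * (δ ^ ((N : ℝ) / 2) * x ^ (-((N : ℝ) / 2 + 1))) := by gcongr
      _ = _ := by rw [hVκ, Real.mul_rpow hδ.le hx.le, ← h2]; ring
  calc _ ≤ (V * (V * M * mn)) * (K * (r ^ ((N : ℝ) / 2) * x ^ (-((N : ℝ) / 2 + 1)))) := by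
        rw [sq]
        gcongr
        exact hK r hr v hv
    _ = _ := by rw [smoothWeight]; ring

lemma norm_weylSum_le {p m n : ℕ} [Fact p.Prime] {G : Fin n → MvPolynomial (Fin m) (ZMod p)}
    {η ε C : ℝ} (hC : 0 < C) (hε : ε ≤ η) (hG : IsOfType G η C) (v : Fin n → ℤ) :
    ‖weylSum G v‖ ≤ (p : ℝ) ^ m * C *
      ((p : ℝ) ^ (-ε) + {v : Fin n → ℤ | ∀ j, (p : ℤ) ∣ v j}.indicator (fun _ => 1) v) := by
  have hp1 : (1 : ℝ) ≤ p := by exact_mod_cast (Fact.out : p.Prime).one_le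
  have hp : (0 : ℝ) < p := by linarith
  have h := hG v
  rw [div_le_iff₀ (by positivity)] at h
  refine h.trans ?_
  rw [mul_comm _ ((p : ℝ) ^ m), ← mul_assoc]
  gcongr
  have h1 : (0 : ℝ) ≤ (p : ℝ) ^ (-ε) := by positivity
  have h2 : (p : ℝ) ^ (-η) ≤ (p : ℝ) ^ (-ε) :=
    Real.rpow_le_rpow_of_exponent_le hp1 (by linarith)
  by_cases hv : ∀ j, (p : ℤ) ∣ v j
  · rw [if_pos hv, Set.indicator_of_mem (by exact hv)]
    linarith
  · rw [if_neg hv, Set.indicator_of_notMem (by exact hv)]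
    linarith

/-- The discrepancy of a polynomial system for a smoothed ball.  The frequencies outside `pℤⁿ`
contribute through the type of the system, those in `pℤⁿ` through the covolume `pⁿ`. -/
lemma exists_abs_sum_smoothedBall_sub_le (N : ℕ) (hN : 1 ≤ N) :
    ∃ K : ℝ, 0 < K ∧ ∀ (C η ε : ℝ), 0 < C → ε ≤ η → ε ≤ ((N + 1 : ℕ) : ℝ) →
      ∀ (p m : ℕ) [Fact p.Prime] (G : Fin (N + 1) → MvPolynomial (Fin m) (ZMod p)),
      IsOfType G η C → ∀ (y : UnitAddTorus (Fin (N + 1))) (δ r : ℝ), 0 < δ → δ < 1 / 2 → 0 < r →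
      |(∑ x : Fin m → ZMod p, (smoothedBall δ r (torusPoint G x - y)).toReal) / (p : ℝ) ^ m -
        volume.real (Metric.closedBall (0 : EuclideanSpace ℝ (Fin (N + 1))) δ) ^ 2 *
          volume.real (Metric.closedBall (0 : EuclideanSpace ℝ (Fin (N + 1))) r)| ≤
        volume.real (Metric.closedBall (0 : EuclideanSpace ℝ (Fin (N + 1))) δ) ^ 2 *
          (K * C * (p : ℝ) ^ (-ε) * (r / δ) ^ ((N : ℝ) / 2)) := by
  obtain ⟨K, hK0, hK⟩ := exists_norm_ballCoeff_sq_mul_le N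
  refine ⟨K * (2 * (5 ^ (N + 1) * 13)), by positivity, ?_⟩
  intro C η ε hC hεη hεn p m _ G hG y δ r hδ hδ2 hr
  have hp1 : (1 : ℝ) ≤ p := by exact_mod_cast (Fact.out : p.Prime).one_le
  have hp : (0 : ℝ) < p := by linarith
  have hpm : (0 : ℝ) < (p : ℝ) ^ m := by positivity
  set V := volume.real (Metric.closedBall (0 : EuclideanSpace ℝ (Fin (N + 1))) δ) with hV
  set W := volume.real (Metric.closedBall (0 : EuclideanSpace ℝ (Fin (N + 1))) r) with hW
  set T := ∑ x : Fin m → ZMod p, (smoothedBall δ r (torusPoint G x - y)).toReal with hT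
  set b : ℝ := (N : ℝ) / 2 with hb
  set D : Set (Fin (N + 1) → ℤ) := {v | ∀ j, (p : ℤ) ∣ v j} with hD
  have hsum := hasSum_sum_smoothedBall G y hδ2 r
  set f : (Fin (N + 1) → ℤ) → ℂ := fun v => ((‖ballCoeff δ v‖ ^ 2 : ℝ) : ℂ) * ballCoeff r v *
      UnitAddTorus.mFourier v (-y) * weylSum G v with hf
  have hf0 : f 0 = ((V ^ 2 * W * (p : ℝ) ^ m : ℝ) : ℂ) := by
    have hw : weylSum G 0 = (p : ℂ) ^ m := by
      simp [weylSum, Fintype.card_pi, ZMod.card]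
    simp only [hf, hw, ballCoeff_zero, UnitAddTorus.mFourier_zero, ← hV, ← hW]
    simp only [Complex.norm_real, Real.norm_eq_abs, sq_abs, ContinuousMap.one_apply]
    push_cast
    ring
  have hterm : ∀ v, v ≠ 0 → ‖f v‖ ≤ (p : ℝ) ^ m * (V ^ 2 * (K * C * r ^ b)) *
      (((p : ℝ) ^ (-ε) + D.indicator (fun _ => 1) v) * smoothWeight b δ ‖intVec v‖) := by
    intro v hv
    have h1 := hK δ r hδ hr v hv
    have h2 := norm_weylSum_le hC hεη hG v
    have hsw : 0 ≤ smoothWeight b δ ‖intVec v‖ := smoothWeight_nonneg hδ.le (norm_nonneg _)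
    rw [hf]
    simp only [norm_mul, norm_mFourier_apply, mul_one, Complex.norm_real,
      Real.norm_of_nonneg (sq_nonneg ‖ballCoeff δ v‖)]
    calc _ ≤ (V ^ 2 * (K * (r ^ b * smoothWeight b δ ‖intVec v‖))) * ((p : ℝ) ^ m * C *
        ((p : ℝ) ^ (-ε) + D.indicator (fun _ => 1) v)) :=
          mul_le_mul h1 h2 (norm_nonneg _) (by positivity)
      _ = _ := by ring
  have hbound : ∀ s : Finset (Fin (N + 1) → ℤ), 0 ∉ s →
      ∑ v ∈ s, ((p : ℝ) ^ (-ε) + D.indicator (fun _ => 1) v) * smoothWeight b δ ‖intVec v‖ ≤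
        2 * (5 ^ (N + 1) * 13) * ((p : ℝ) ^ (-ε) * δ ^ (-b)) := by
    intro s hs
    classical
    have h1 := sum_smoothWeight_le N hN hδ s hs
    have h2 := sum_smoothWeight_le_of_dvd N hN hδ (Fact.out : p.Prime).pos
      (s.filter fun v => v ∈ D) (fun h => hs (Finset.mem_filter.1 h).1)
      (fun v hv => (Finset.mem_filter.1 hv).2)
    have h3 : ∑ v ∈ s, D.indicator (fun _ => (1 : ℝ)) v * smoothWeight b δ ‖intVec v‖ =
        ∑ v ∈ s with v ∈ D, smoothWeight b δ ‖intVec v‖ := by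
      rw [Finset.sum_filter]
      refine Finset.sum_congr rfl fun v _ => ?_
      by_cases hv : v ∈ D <;> simp [hv]
    have h4 : (p : ℝ) ^ (-((N + 1 : ℕ) : ℝ)) ≤ (p : ℝ) ^ (-ε) :=
      Real.rpow_le_rpow_of_exponent_le hp1 (by linarith)
    simp only [add_mul, Finset.sum_add_distrib, ← Finset.mul_sum]
    rw [h3]
    calc _ ≤ (p : ℝ) ^ (-ε) * (5 ^ (N + 1) * 13 * δ ^ (-b)) +
          5 ^ (N + 1) * 13 * ((p : ℝ) ^ (-ε) * δ ^ (-b)) := by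
          refine add_le_add (by gcongr) (h2.trans ?_)
          gcongr
      _ = _ := by ring
  have hmain : ‖((T : ℝ) : ℂ) - f 0‖ ≤ (p : ℝ) ^ m * (V ^ 2 * (K * C * r ^ b)) *
      (2 * (5 ^ (N + 1) * 13) * ((p : ℝ) ^ (-ε) * δ ^ (-b))) := by
    classical
    have h1 := hsum.update 0 0
    rw [zero_sub, neg_add_eq_sub] at h1
    refine le_of_tendsto' (Filter.Tendsto.norm h1) fun s => ?_
    calc ‖∑ v ∈ s, Function.update f 0 0 v‖ = ‖∑ v ∈ s.erase 0, f v‖ := by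
          rw [← Finset.sum_erase s (a := 0) (by simp)]
          congr 1
          exact Finset.sum_congr rfl fun v hv =>
            Function.update_of_ne (Finset.ne_of_mem_erase hv) _ _
      _ ≤ ∑ v ∈ s.erase 0, ‖f v‖ := norm_sum_le _ _
      _ ≤ ∑ v ∈ s.erase 0, (p : ℝ) ^ m * (V ^ 2 * (K * C * r ^ b)) *
          (((p : ℝ) ^ (-ε) + D.indicator (fun _ => 1) v) * smoothWeight b δ ‖intVec v‖) :=
          Finset.sum_le_sum fun v hv => hterm v (Finset.ne_of_mem_erase hv)
      _ ≤ _ := by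
          rw [← Finset.mul_sum]
          gcongr
          exact hbound _ (Finset.notMem_erase 0 s)
  rw [hf0, ← Complex.ofReal_sub, Complex.norm_real, Real.norm_eq_abs] at hmain
  have e : T / (p : ℝ) ^ m - V ^ 2 * W = (T - V ^ 2 * W * (p : ℝ) ^ m) / (p : ℝ) ^ m := by
    field_simp
  rw [e, abs_div, abs_of_pos hpm, div_le_iff₀ hpm]
  refine hmain.trans_eq ?_
  rw [Real.div_rpow hr.le hδ.le, Real.rpow_neg hδ.le]
  ring

/-! ### Sandwiching the ball and choosing the scale -/

lemma smoothedBall_lt_top {n : ℕ} (δ r : ℝ) (x : UnitAddTorus (Fin n)) :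
    smoothedBall δ r x < ⊤ := by
  have h1 : smoothedBall δ r x ≤ ∫⁻ _ in Metric.closedBall (0 : EuclideanSpace ℝ (Fin n)) r,
      (volume : Measure (UnitAddTorus (Fin n))) Set.univ :=
    lintegral_mono fun u => measure_mono (Set.subset_univ _)
  refine h1.trans_lt ?_
  rw [setLIntegral_const]
  exact ENNReal.mul_lt_top (measure_lt_top _ _) measure_closedBall_lt_top

lemma systemMeasure_eq_sum {p m n : ℕ} [Fact p.Prime]
    (G : Fin n → MvPolynomial (Fin m) (ZMod p)) (B : Set (UnitAddTorus (Fin n))) :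
    systemMeasure G B = (∑ x : Fin m → ZMod p, B.indicator (fun _ => (1 : ℝ)) (torusPoint G x)) /
      (p : ℝ) ^ m := by
  classical
  rw [systemMeasure]
  congr 1
  simp only [Set.indicator_apply]
  rw [Finset.sum_boole, Set.ncard_eq_toFinset_card']
  congr 2
  ext x
  simp

/-- Sandwiching the ball between smoothed balls of radii `R ± 2δ`: discrepancy bounds in which
the smoothing scale `δ` is still free. -/
lemma exists_systemMeasure_torusBall_bounds (N : ℕ) (hN : 1 ≤ N) :
    ∃ K : ℝ, 0 < K ∧ ∀ (C η ε : ℝ), 0 < C → ε ≤ η → ε ≤ ((N + 1 : ℕ) : ℝ) →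
      ∀ (p m : ℕ) [Fact p.Prime] (G : Fin (N + 1) → MvPolynomial (Fin m) (ZMod p)),
      IsOfType G η C → ∀ (y : UnitAddTorus (Fin (N + 1))) (δ R : ℝ), 0 < δ → δ < 1 / 2 → 0 < R →
      systemMeasure G (torusBall y R) ≤
        volume.real (Metric.closedBall (0 : EuclideanSpace ℝ (Fin (N + 1))) (R + 2 * δ)) +
          K * C * (p : ℝ) ^ (-ε) * ((R + 2 * δ) / δ) ^ ((N : ℝ) / 2) ∧
      (2 * δ < R → R < 1 / 2 →
        volume.real (Metric.closedBall (0 : EuclideanSpace ℝ (Fin (N + 1))) (R - 2 * δ)) -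
          K * C * (p : ℝ) ^ (-ε) * ((R - 2 * δ) / δ) ^ ((N : ℝ) / 2) ≤
        systemMeasure G (torusBall y R)) := by
  obtain ⟨K, hK0, hK⟩ := exists_abs_sum_smoothedBall_sub_le N hN
  refine ⟨K, hK0, ?_⟩
  intro C η ε hC hεη hεn p m _ G hG y δ R hδ hδ2 hR
  have hp : (0 : ℝ) < p := by exact_mod_cast (Fact.out : p.Prime).pos
  have hpm : (0 : ℝ) < (p : ℝ) ^ m := by positivity
  have hVκ := volume_real_closedBall_zero (N + 1) hδ.le
  have hκ := volume_real_unitBall_pos (N + 1)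
  have hK' := fun r hr => hK C η ε hC hεη hεn p m G hG y δ r hδ hδ2 hr
  set V := volume.real (Metric.closedBall (0 : EuclideanSpace ℝ (Fin (N + 1))) δ) with hV
  have hV0 : 0 < V ^ 2 := by rw [hVκ]; positivity
  have hVE : (volume (Metric.closedBall (0 : EuclideanSpace ℝ (Fin (N + 1))) δ) *
      volume (Metric.closedBall (0 : EuclideanSpace ℝ (Fin (N + 1))) δ)).toReal = V ^ 2 := by
    rw [ENNReal.toReal_mul, sq, hV, Measure.real]
  have hcount : V ^ 2 * systemMeasure G (torusBall y R) = (∑ x : Fin m → ZMod p,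
      V ^ 2 * (torusBall y R).indicator (fun _ => (1 : ℝ)) (torusPoint G x)) / (p : ℝ) ^ m := by
    rw [systemMeasure_eq_sum, ← Finset.mul_sum, mul_div_assoc]
  constructor
  · have h := (abs_le.1 (hK' (R + 2 * δ) (by linarith))).2
    have h2 : V ^ 2 * systemMeasure G (torusBall y R) ≤ (∑ x : Fin m → ZMod p,
        (smoothedBall δ (R + 2 * δ) (torusPoint G x - y)).toReal) / (p : ℝ) ^ m := by
      rw [hcount]
      gcongr with x
      by_cases hx : torusPoint G x ∈ torusBall y R
      · rw [Set.indicator_of_mem hx, mul_one, ← hVE]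
        exact ENNReal.toReal_mono (smoothedBall_lt_top _ _ _).ne
          (le_smoothedBall hδ2 (mem_torusBall_iff_sub_mem.1 hx))
      · rw [Set.indicator_of_notMem hx, mul_zero]
        exact ENNReal.toReal_nonneg
    refine le_of_mul_le_mul_left ?_ hV0
    rw [mul_add]
    linarith
  · intro hδR hR2
    have h := (abs_le.1 (hK' (R - 2 * δ) (by linarith))).1
    have h2 : (∑ x : Fin m → ZMod p,
        (smoothedBall δ (R - 2 * δ) (torusPoint G x - y)).toReal) / (p : ℝ) ^ m ≤
          V ^ 2 * systemMeasure G (torusBall y R) := by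
      rw [hcount]
      gcongr with x
      by_cases hx : torusPoint G x ∈ torusBall y R
      · rw [Set.indicator_of_mem hx, mul_one, ← hVE]
        refine ENNReal.toReal_mono ?_ (smoothedBall_le hδ2 (by linarith) _)
        exact (ENNReal.mul_lt_top measure_closedBall_lt_top measure_closedBall_lt_top).ne
      · rw [Set.indicator_of_notMem hx, mul_zero, smoothedBall_eq_zero, ENNReal.toReal_zero]
        rwa [sub_add_cancel, ← mem_torusBall_iff_sub_mem]
    refine le_of_mul_le_mul_left ?_ hV0
    rw [mul_sub]
    linarith

lemma pow_sub_pow_le_mul {x y : ℝ} (hy : 0 ≤ y) (hyx : y ≤ x) (N : ℕ) :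
    x ^ (N + 1) - y ^ (N + 1) ≤ (N + 1) * (x - y) * x ^ N := by
  induction N with
  | zero => simp
  | succ k ih =>
    have hx : 0 ≤ x := hy.trans hyx
    have h1 : y ^ (k + 1) ≤ x ^ (k + 1) := pow_le_pow_left₀ hy hyx _
    have h2 := mul_le_mul_of_nonneg_right ih hx
    have h3 := mul_le_mul_of_nonneg_right h1 (sub_nonneg.2 hyx)
    push_cast
    have e1 : x ^ (k + 1 + 1) - y ^ (k + 1 + 1) =
      (x ^ (k + 1) - y ^ (k + 1)) * x + y ^ (k + 1) * (x - y) := by ring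
    have e2 : ((k : ℝ) + 1 + 1) * (x - y) * x ^ (k + 1) =
      (k + 1) * (x - y) * x ^ k * x + x ^ (k + 1) * (x - y) := by ring
    linarith

/-- The optimal smoothing scale `δ₀ = q^{2/(n+1)} R^{-(n-1)/(n+1)}`, where `n = N + 1`: the two
error terms `R^{n-1} δ₀` and `q (R/δ₀)^{(n-1)/2}` agree, and `δ₀ < R` exactly when `q < Rⁿ`. -/
lemma smoothing_scale (N : ℕ) {q R : ℝ} (hq : 0 < q) (hR : 0 < R) (hqR : q < R ^ (N + 1)) :
    ∃ δ₀ : ℝ, 0 < δ₀ ∧ δ₀ < R ∧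
      R ^ N * δ₀ = R ^ (((N : ℝ) + 1) * N / (N + 2)) * q ^ (2 / ((N : ℝ) + 2)) ∧
      q * (R / δ₀) ^ ((N : ℝ) / 2) = R ^ N * δ₀ := by
  have hN2 : (0 : ℝ) < N + 2 := by positivity
  set δ₀ := q ^ (2 / ((N : ℝ) + 2)) * R ^ (-((N : ℝ) / (N + 2))) with hδ
  have hδ0 : 0 < δ₀ := by positivity
  have hpow : δ₀ ^ ((N : ℝ) / 2 + 1) = q * R ^ (-((N : ℝ) / 2)) := by
    rw [hδ, Real.mul_rpow (by positivity) (by positivity), ← Real.rpow_mul hq.le,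
      ← Real.rpow_mul hR.le]
    congr 1
    · rw [show 2 / ((N : ℝ) + 2) * ((N : ℝ) / 2 + 1) = 1 by field_simp, Real.rpow_one]
    · congr 1
      field_simp
  refine ⟨δ₀, hδ0, ?_, ?_, ?_⟩
  · calc δ₀ < (R ^ (N + 1)) ^ (2 / ((N : ℝ) + 2)) * R ^ (-((N : ℝ) / (N + 2))) := by
          rw [hδ]; gcongr
      _ = R := by
          rw [← Real.rpow_natCast, ← Real.rpow_mul hR.le, ← Real.rpow_add hR]
          convert Real.rpow_one R using 2
          push_cast
          field_simp
          ring
  · rw [hδ, ← Real.rpow_natCast, mul_left_comm, ← Real.rpow_add hR, mul_comm]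
    congr 2
    field_simp
    ring
  · have h1 : q = δ₀ ^ ((N : ℝ) / 2 + 1) * R ^ ((N : ℝ) / 2) := by
      rw [hpow, mul_assoc, ← Real.rpow_add hR, neg_add_cancel, Real.rpow_zero, mul_one]
    rw [Real.div_rpow hR.le hδ0.le, ← Real.rpow_natCast]
    nth_rw 1 [h1]
    rw [Real.rpow_add_one hδ0.ne']
    have h2 : R ^ ((N : ℝ)) = R ^ ((N : ℝ) / 2) * R ^ ((N : ℝ) / 2) := by
      rw [← Real.rpow_add hR, add_halves]
    rw [h2]
    have h3 : 0 < δ₀ ^ ((N : ℝ) / 2) := by positivity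
    field_simp

theorem theorem1p5 (n : ℕ) (hn : 2 ≤ n) (C : ℝ) (hC : 0 < C) :
    ∃ K : ℝ, 0 < K ∧
      ∀ (η : ℝ), 0 ≤ η →
      ∀ (p m : ℕ) [Fact p.Prime] (G : Fin n → MvPolynomial (Fin m) (ZMod p)), IsOfType G η C →
      ∀ (y : UnitAddTorus (Fin n)) (R : ℝ), 0 < R → R < 1 / 2 →
        ((p : ℝ) ^ (-(min η (n : ℝ) / (n : ℝ))) < R →
          |systemMeasure G (torusBall y R) -
              (volume : Measure (UnitAddTorus (Fin n))).real (torusBall y R)| ≤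
            K * (R ^ ((n : ℝ) * ((n : ℝ) - 1) / ((n : ℝ) + 1)) *
                (p : ℝ) ^ (-(2 * min η (n : ℝ) / ((n : ℝ) + 1))))) ∧
        (R ≤ (p : ℝ) ^ (-(min η (n : ℝ) / (n : ℝ))) →
          |systemMeasure G (torusBall y R) -
              (volume : Measure (UnitAddTorus (Fin n))).real (torusBall y R)| ≤
            K * (p : ℝ) ^ (-min η (n : ℝ))) := by
  obtain ⟨N, rfl⟩ : ∃ N, n = N + 1 := ⟨n - 1, by omega⟩
  obtain ⟨K, hK0, hK⟩ := exists_systemMeasure_torusBall_bounds N (by omega)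
  have hκ := volume_real_unitBall_pos (N + 1)
  have hvol := fun r hr => volume_real_closedBall_zero (N + 1) (r := r) hr
  set κ := volume.real (Metric.ball (0 : EuclideanSpace ℝ (Fin (N + 1))) 1) with hκdef
  refine ⟨κ * (N + 1) * 2 ^ (N + 1) + K * C * 8 ^ ((N : ℝ) / 2), by positivity, ?_⟩
  intro η hη p m _ G hG y R hR hR2
  have hp1 : (1 : ℝ) ≤ p := by exact_mod_cast (Fact.out : p.Prime).one_le
  have hp : (0 : ℝ) < p := by linarith
  have hn0 : (0 : ℝ) < ((N + 1 : ℕ) : ℝ) := by positivity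
  set ε := min η ((N + 1 : ℕ) : ℝ) with hε
  have hε0 : 0 ≤ ε := le_min hη hn0.le
  set q := (p : ℝ) ^ (-ε) with hq
  have hq0 : 0 < q := by positivity
  have hq1 : q ≤ 1 := Real.rpow_le_one_of_one_le_of_nonpos hp1 (by linarith)
  set R₀ := (p : ℝ) ^ (-(ε / ((N + 1 : ℕ) : ℝ))) with hR₀
  have hR₀0 : 0 < R₀ := by positivity
  have hR₀q : R₀ ^ (N + 1) = q := by
    rw [hR₀, ← Real.rpow_natCast, ← Real.rpow_mul hp.le, hq]
    congr 1
    field_simp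
  have hμ : (volume : Measure (UnitAddTorus (Fin (N + 1)))).real (torusBall y R) =
      R ^ (N + 1) * κ := by
    rw [Measure.real, volume_torusBall y hR2]
    exact hvol R hR.le
  have hKb := hK C η ε hC (min_le_left _ _) (min_le_right _ _) p m G hG y
  have h8 : (0 : ℝ) ≤ K * C * 8 ^ ((N : ℝ) / 2) := by positivity
  have hκN : (0 : ℝ) ≤ κ * (N + 1) * 2 ^ (N + 1) := by positivity
  rw [hμ]
  constructor
  · intro hRR
    have hqR : q < R ^ (N + 1) := by
      rw [← hR₀q]
      exact pow_lt_pow_left₀ hRR hR₀0.le (Nat.succ_ne_zero N)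
    obtain ⟨δ₀, hδ0, hδR, hT, hbal⟩ := smoothing_scale N hq0 hR hqR
    have hexp : R ^ (((N + 1 : ℕ) : ℝ) * (((N + 1 : ℕ) : ℝ) - 1) / (((N + 1 : ℕ) : ℝ) + 1)) *
        (p : ℝ) ^ (-(2 * ε / (((N + 1 : ℕ) : ℝ) + 1))) = R ^ N * δ₀ := by
      rw [hT, hq, ← Real.rpow_mul hp.le]
      congr 2
      · push_cast; ring
      · push_cast; ring
    rw [hexp]
    -- Smoothing at scale `δ₀ / 4` keeps both radii `R ± δ₀ / 2` positive and below `2R`.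
    obtain ⟨hup, hlow⟩ := hKb (δ₀ / 4) R (by linarith) (by linarith) hR
    have hlow := hlow (by linarith) hR2
    have herr : ∀ r : ℝ, 0 ≤ r → r ≤ 2 * R → K * C * q * (r / (δ₀ / 4)) ^ ((N : ℝ) / 2) ≤
        K * C * 8 ^ ((N : ℝ) / 2) * (R ^ N * δ₀) := by
      intro r hr0 hr
      calc _ ≤ K * C * q * (8 * (R / δ₀)) ^ ((N : ℝ) / 2) := by
            gcongr
            calc r / (δ₀ / 4) ≤ 2 * R / (δ₀ / 4) := by gcongr
              _ = 8 * (R / δ₀) := by ring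
        _ = K * C * 8 ^ ((N : ℝ) / 2) * (q * (R / δ₀) ^ ((N : ℝ) / 2)) := by
            rw [Real.mul_rpow (by norm_num) (by positivity)]
            ring
        _ = _ := by rw [hbal]
    have hvol1 : ∀ a b : ℝ, 0 ≤ a → a ≤ b → b ≤ 2 * R → b - a ≤ δ₀ →
        b ^ (N + 1) * κ - a ^ (N + 1) * κ ≤ κ * (N + 1) * 2 ^ (N + 1) * (R ^ N * δ₀) := by
      intro a b ha hab hb hba
      rw [← sub_mul]
      calc _ ≤ (N + 1) * (b - a) * b ^ N * κ := by
            gcongr; exact pow_sub_pow_le_mul ha hab N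
        _ ≤ (N + 1) * δ₀ * (2 * R) ^ N * κ := by
            have : 0 ≤ b := ha.trans hab
            gcongr
        _ = κ * (N + 1) * 2 ^ N * (R ^ N * δ₀) := by rw [mul_pow]; ring
        _ ≤ _ := by
            gcongr
            · norm_num
            · omega
    rw [hvol _ (by linarith)] at hup hlow
    have e1 := herr (R + 2 * (δ₀ / 4)) (by linarith) (by linarith)
    have e2 := herr (R - 2 * (δ₀ / 4)) (by linarith) (by linarith)
    have v1 := hvol1 R (R + 2 * (δ₀ / 4)) hR.le (by linarith) (by linarith) (by linarith)
    have v2 := hvol1 (R - 2 * (δ₀ / 4)) R (by linarith) (by linarith) (by linarith) (by linarith)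
    rw [abs_le, add_mul]
    constructor <;> linarith
  · intro hRR
    have hR₀1 : R₀ ≤ 1 := Real.rpow_le_one_of_one_le_of_nonpos hp1
      (neg_nonpos.2 (div_nonneg hε0 hn0.le))
    -- Both quantities are at most `O(q)`: the volume because `R ≤ R₀`, the count by the upper
    -- bound at the larger radius `R₀`, which needs no smallness of `R₀`.
    have hup := (hKb (R₀ / 4) R₀ (by linarith) (by linarith) hR₀0).1
    have hmono : systemMeasure G (torusBall y R) ≤ systemMeasure G (torusBall y R₀) := by
      rw [systemMeasure, systemMeasure]
      gcongr
      · exact Set.toFinite _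
      · exact torusBall_mono hRR
    have h0 : 0 ≤ systemMeasure G (torusBall y R) := by
      rw [systemMeasure]; positivity
    rw [hvol _ (by linarith), show R₀ + 2 * (R₀ / 4) = 3 / 2 * R₀ by ring, mul_pow, hR₀q,
      show 3 / 2 * R₀ / (R₀ / 4) = 6 by field_simp; norm_num] at hup
    have hRq : R ^ (N + 1) ≤ q := by rw [← hR₀q]; gcongr
    have h1 : (3 / 2 : ℝ) ^ (N + 1) * q * κ ≤ κ * (N + 1) * 2 ^ (N + 1) * q := by
      have ha : (3 / 2 : ℝ) ^ (N + 1) ≤ 2 ^ (N + 1) := by gcongr; norm_num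
      have hb : (2 : ℝ) ^ (N + 1) ≤ (N + 1) * 2 ^ (N + 1) :=
        le_mul_of_one_le_left (by positivity) (by linarith [(N.cast_nonneg : (0 : ℝ) ≤ N)])
      calc _ ≤ ((N + 1) * 2 ^ (N + 1)) * q * κ := by gcongr; exact ha.trans hb
        _ = _ := by ring
    have h2 : K * C * q * 6 ^ ((N : ℝ) / 2) ≤ K * C * 8 ^ ((N : ℝ) / 2) * q := by
      calc _ ≤ K * C * q * 8 ^ ((N : ℝ) / 2) := by gcongr; norm_num
        _ = _ := by ring
    have h3 : R ^ (N + 1) * κ ≤ κ * (N + 1) * 2 ^ (N + 1) * q := by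
      have hb : (1 : ℝ) ≤ (3 / 2) ^ (N + 1) := one_le_pow₀ (by norm_num)
      refine le_trans ?_ h1
      gcongr
      nlinarith
    have h4 : 0 ≤ R ^ (N + 1) * κ := by positivity
    have h5 : 0 ≤ K * C * 8 ^ ((N : ℝ) / 2) * q := by positivity
    have h6 : 0 ≤ κ * (N + 1) * 2 ^ (N + 1) * q := by positivity
    rw [abs_le, add_mul]
    constructor <;> linarith
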